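/- **Theorem 4.10.** Let $\zeta_3$ be a primitive cube root of unity, $\sqrt{-3} := 2\zeta_3+1$, $k = \mathbb{Q}(\zeta_3)$, and let $\mathcal{O}_F$ denote the ring of integers of a number field $F$. Fix an algebraic closure $\overline{k}$ of $k$. Let $\mathfrak{p}_1 \neq \mathfrak{p}_2$ be finite primes of $k$ with $\mathrm{N}\mathfrak{p}_i \equiv 1 \bmod 9$, and let $\pi_i \in \mathcal{O}_k$ be the generator of $\mathfrak{p}_i$ with $\pi_i \equiv 1 \bmod (3\sqrt{-3})$ $(i=1,2)$. Assume that the cubic residue symbols satisfy $$\left(\frac{\pi_1}{\pi_2}\right)_3 = \left(\frac{\pi_2}{\pi_1}\right)_3 = 1 .$$ Let $K_1 = k(\sqrt[3]{\pi_1}) \subset \overline{k}$, let $\tau \in \mathrm{Gal}(K_1/k)$ be given by $\tau(\sqrt[3]{\pi_1}) = \zeta_3\sqrt[3]{\pi_1}$, let $\mathfrak{P}$ be a prime of $K_1$ lying over $\mathfrak{p}_2$, and put $\mathfrak{P}^{(1)} = \mathfrak{P}$, $\mathfrak{P}^{(2)} = \tau(\mathfrak{P})$. Let $\theta \in \mathcal{O}_{K_1}$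 satisfy the following conditions: * $\mathrm{N}_{K_1/k}(\theta) = \pi_2^3 w^3$ for some $w \in k$; * $(\theta) = (\mathfrak{P}^{(1)})^{2e}(\mathfrak{P}^{(2)})^{e}\mathfrak{A}^{a}$ for some integers $e, a$ with $(e,3)=1$ and $a \equiv 0 \bmod 3$ and some ideal $\mathfrak{A}$ of $\mathcal{O}_{K_1}$ prime to $3$; * there is $\eta \in \mathcal{O}_{K_1}$ with $\eta^3 \equiv \theta \bmod (3\sqrt{-3})$. Put $\theta^{(1)} = \theta$, $\theta^{(2)} = \tau(\theta)$, $\theta^{(3)} = \tau^2(\theta)$, and let $\mathfrak{R}_\theta = k(\sqrt[3]{\pi_1}, \sqrt[3]{\pi_2}, \sqrt[3]{\theta}) \subset \overline{k}$. Then, for any choice of the cube roots: 1. $\mathfrak{R}_\theta = k(\sqrt[3]{\theta^{(1)}}, \sqrt[3]{\theta^{(2)}}, \sqrt[3]{\theta^{(3)}})$. 2. $\mathfrak{R}_\theta/k$ is a Galois extension that is unramified at every place of $k$ (finite or infinite) other than $\mathfrak{p}_1$ and $\mathfrak{p}_2$, and the ramification index of each $\mathfrak{p}_i$ in $\mathfrak{R}_\theta/k$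 is $3$. 3. $\mathrm{Gal}(\mathfrak{R}_\theta/k)$ is isomorphic to the Heisenberg group $N_3(\mathbb{F}_3)$ (of order $27$) of upper triangular $3\times 3$ matrices over $\mathbb{F}_3$ with all diagonal entries equal to $1$. -/

import Mathlib

open NumberField
open scoped IntermediateField nonZeroDivisors

/-- A simple extension `k(ρ)` of a number field by an algebraic element is a number field. -/
instance numberFieldAdjoinSimple {k Ω : Type*} [Field k] [NumberField k] [Field Ω] [Algebra k Ω]
    [Algebra.IsAlgebraic k Ω] (ρ : Ω) : NumberField k⟮ρ⟯ :=
  haveI := IntermediateField.adjoin.finiteDimensional (K := k)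
    (Algebra.IsAlgebraic.isAlgebraic (R := k) ρ).isIntegral
  NumberField.of_module_finite k k⟮ρ⟯

/-- The group `N_n(R)` of upper triangular `n × n` matrices over `R` with all diagonal entries `1`,
as a subgroup of `GL_n(R)` (`Submonoid.units` asks the matrix and its inverse to be of this form;
the latter is automatic).  For `n = 3` this is the Heisenberg group over `R`. -/
def unitriangularGroup (n : ℕ) (R : Type*) [CommRing R] : Subgroup (GL (Fin n) R) :=
  Submonoid.units
    { carrier := {M : Matrix (Fin n) (Fin n) R | (∀ i, M i i = 1) ∧ ∀ i j, j < i → M i j = 0}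
      one_mem' := ⟨fun i => Matrix.one_apply_eq i, fun _ _ h => Matrix.one_apply_ne h.ne'⟩
      mul_mem' := by
        rintro A B ⟨hA, hA'⟩ ⟨hB, hB'⟩
        refine ⟨fun i => ?_, fun i j hij => ?_⟩
        · rw [Matrix.mul_apply, Finset.sum_eq_single i]
          · rw [hA, hB, one_mul]
          · intro l _ hl
            rcases lt_or_gt_of_ne hl with h | h
            · rw [hA' i l h, zero_mul]
            · rw [hB' l i h, mul_zero]
          · simp
        · rw [Matrix.mul_apply]
          refine Finset.sum_eq_zero fun l _ => ?_
          rcases lt_or_ge l i with h | h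
          · rw [hA' i l h, zero_mul]
          · rw [hB' l j (hij.trans_le h), mul_zero] }

section Arithmetic

variable {k : Type*} [Field k] [NumberField k]

/-- The element `3√-3` of the ring of integers of `ℚ(ζ)`, where `ζ = (-1 + √-3)/2` is a
primitive cube root of unity, so that `√-3 = 2ζ + 1`. -/
def threeSqrtNegThree (ζ : 𝓞 k) : 𝓞 k := 3 * (2 * ζ + 1)

/-- `ω` is the cubic residue symbol `(a / 𝔭)₃`: the cube root of unity that is congruent to
`a ^ ((N𝔭 - 1) / 3)` modulo `𝔭`.  It is used for primes `𝔭` with `N𝔭 ≡ 1 mod 9` and `a ∉ 𝔭`, where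
such an `ω` exists and is unique. -/
def IsCubicResidueSymbol (a : 𝓞 k) (𝔭 : Ideal (𝓞 k)) (ω : 𝓞 k) : Prop :=
  ω ^ 3 = 1 ∧ a ^ ((Ideal.absNorm 𝔭 - 1) / 3) - ω ∈ 𝔭

/-- `𝔭` is a finite prime with `N𝔭 ≡ 1 mod 9`, and `π` is its generator with `π ≡ 1 mod 3√-3`. -/
structure IsPrimaryGenerator (ζ : 𝓞 k) (𝔭 : Ideal (𝓞 k)) (π : 𝓞 k) : Prop where
  isPrime : 𝔭.IsPrime
  absNorm_modEq : Ideal.absNorm 𝔭 ≡ 1 [MOD 9]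
  eq_span : 𝔭 = Ideal.span {π}
  congr_one : π - 1 ∈ Ideal.span {threeSqrtNegThree ζ}

variable {K₁ : Type*} [Field K₁] [NumberField K₁] [Algebra k K₁]

/-- The conditions on `θ ∈ 𝓞 K₁`, relative to a prime `𝔓` of `K₁` and a `k`-automorphism `τ` of `K₁`:
* `N(θ) = π₂³ w³` for some `w ∈ k`;
* `(θ) = 𝔓 ^ (2e) · τ(𝔓) ^ e · 𝔄 ^ a` with `e` prime to `3`, `𝔄` an ideal of `𝓞 K₁` prime to `3`, and
  `a` divisible by `3` (an identity of fractional ideals, since `e` and `a` may be negative);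
* `η³ ≡ θ mod 3√-3` for some `η ∈ 𝓞 K₁`. -/
structure IsAdmissible (ζ π₂ : 𝓞 k) (τ : K₁ ≃ₐ[k] K₁) (𝔓 : Ideal (𝓞 K₁)) (θ : 𝓞 K₁) : Prop where
  norm_eq : ∃ w : k, Algebra.norm k (θ : K₁) = (π₂ : k) ^ 3 * w ^ 3
  factorization : ∃ (e a : ℤ) (𝔄 : Ideal (𝓞 K₁)),
    IsCoprime e 3 ∧ IsCoprime 𝔄 (Ideal.span {3}) ∧ 3 ∣ a ∧
      FractionalIdeal.spanSingleton (𝓞 K₁)⁰ (θ : K₁) =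
        (𝔓 : FractionalIdeal (𝓞 K₁)⁰ K₁) ^ (2 * e) *
        ((𝔓.map (RingOfIntegers.mapAlgEquiv τ) : Ideal (𝓞 K₁)) :
          FractionalIdeal (𝓞 K₁)⁰ K₁) ^ e *
        (𝔄 : FractionalIdeal (𝓞 K₁)⁰ K₁) ^ a
  cube_congr : ∃ η : 𝓞 K₁,
    η ^ 3 - θ ∈ Ideal.span {algebraMap (𝓞 k) (𝓞 K₁) (threeSqrtNegThree ζ)}

end Arithmetic

/-! Everything rests on one relation in K₁ (`exists_apply_theta_eq`): τθ = θ · π₂^n · x³ with n = 1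
or 2. Modulo cubes of ideals, (θ) is P^(2e) · (τP)^e, so (τθ/θ) is the e-th power of P · τP · τ²P =
(π₂); the three primes are distinct because π₁ is a cube modulo π₂. Write N(θ) = c³ with c in k.
Hilbert 90 for c/τθ gives κ such that τθ/(θ π₂^n κ³) is an element b of k, and every order of b in
K₁ is divisible by 3. Since k is principal with units ±ζ^i, and K₁/k ramifies only at π₁ = ρ₁³, b is
a cube root of unity times a cube of K₁. Comparison with η³ ≡ θ mod 3√-3 at a prime over √-3 shows
that this root of unity is 1.

Up to cube roots of unity the relation reads t₂ = t₁ ρ₂^n x, and likewise for t₃. With k(θ) = K₁,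
this gives the second description of the field and its normality.

Ramification is read off inertia groups. An inertia element at w multiplies a radical by some ω with
ω³ = 1, and ω ≠ 1 would make ω - 1 a unit times √-3. Away from 3 this is impossible if the radical
has the same order at w as some fixed element (`eq_one_of_mem_inertia_of_tame`). Above 3 the
congruence modulo 3√-3 makes (t - η)/√-3 integral, which is again contradictory
(`eq_one_of_mem_inertia_of_wild`). Hence inertia is trivial away from π₁π₂. Above πᵢ it is
determined by its action on ρᵢ, so it has order at most 3; the order is a multiple of 3 because πᵢ
becomes a cube.

For the group, set s₀ = t, s₁ = ρ₂^n x s₀, s₂ = ρ₂^n τ(x) s₁. The chain closes up modulo 3 because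
π₂^n N(x) = 1 exactly (`mul_norm_eq_one`). If σ has Kummer exponents a on ρ₁ and b on ρ₂, and σ(s₀)
= ζ^c s_a, then σ(s_j) = ζ^(c + nbj) s_(j+a). Hence c(gh) = c(g) + c(h) + n b(g) a(h), the
Heisenberg law. The inertia groups above π₁ and π₂ supply elements with (a ≠ 0, b = 0) and (a = 0, b
≠ 0), and their commutator generates the centre. -/

open IsDedekindDomain HeightOneSpectrum

/-! ### Cube roots of unity -/

section CubeRoots

variable {A : Type*} [CommRing A] [IsDomain A]

theorem cube_eq_one_cases {z ω : A} (hz : z ^ 2 + z + 1 = 0) (hω : ω ^ 3 = 1) :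
    ω = 1 ∨ ω = z ∨ ω = z ^ 2 := by
  have : (ω - 1) * ((ω - z) * (ω - z ^ 2)) = 0 := by
    linear_combination hω + (-ω ^ 2 + ω * z - (z - 1)) * hz
  rcases mul_eq_zero.1 this with h | h
  · exact Or.inl (sub_eq_zero.1 h)
  · rcases mul_eq_zero.1 h with h | h
    · exact Or.inr (Or.inl (sub_eq_zero.1 h))
    · exact Or.inr (Or.inr (sub_eq_zero.1 h))

/-- With `2 * z + 1` in the role of √-3, this converts ω ≠ 1 into a statement about a single
element; every comparison of roots of unity at a prime uses it. -/
theorem exists_unit_sub_one_eq {z ω : A} (hz : z ^ 2 + z + 1 = 0) (hω : ω ^ 3 = 1) (h1 : ω ≠ 1) :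
    ∃ ε : Aˣ, ω - 1 = ε * (2 * z + 1) := by
  have hz3 : z ^ 3 = 1 := by linear_combination (z - 1) * hz
  have hu : IsUnit z := IsUnit.of_pow_eq_one hz3 (by norm_num)
  obtain ⟨u, rfl⟩ := hu
  rcases cube_eq_one_cases hz hω with h | h | h
  · exact absurd h h1
  · refine ⟨-u ^ 2, ?_⟩
    rw [h]
    push_cast
    linear_combination 2 * hz3 + hz
  · refine ⟨u, ?_⟩
    rw [h]
    linear_combination -hz

theorem exists_cube_root_unity_mul {F : Type*} [Field F] {a b : F} (h : a ^ 3 = b ^ 3) :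
    ∃ ω : F, ω ^ 3 = 1 ∧ a = ω * b := by
  by_cases hb : b = 0
  · refine ⟨1, one_pow 3, ?_⟩
    rw [hb] at h ⊢
    simpa using h
  · exact ⟨a / b, by rw [div_pow, h, div_self (pow_ne_zero 3 hb)], by field_simp⟩

end CubeRoots

/-! ### Inertia groups acting on cube roots -/

section Inertia

variable {F L : Type*} [Field F] [NumberField F] [Field L] [NumberField L] [Algebra F L]

theorem valuation_algebraMap_lt_one_iff (w : HeightOneSpectrum (𝓞 L)) (x : 𝓞 L) :
    w.valuation L (algebraMap (𝓞 L) L x) < 1 ↔ x ∈ w.asIdeal :=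
  valuation_lt_one_iff_mem w x

theorem valuation_algebraMap_eq_one_iff (w : HeightOneSpectrum (𝓞 L)) (x : 𝓞 L) :
    w.valuation L (algebraMap (𝓞 L) L x) = 1 ↔ x ∉ w.asIdeal := by
  rw [← valuation_algebraMap_lt_one_iff, not_lt]
  exact ⟨fun h => h.ge, fun h => le_antisymm (w.valuation_le_one x) h⟩

omit [NumberField F] [NumberField L] in
theorem algebraMap_smul_integer (σ : L ≃ₐ[F] L) (x : 𝓞 L) :
    algebraMap (𝓞 L) L (σ • x) = σ (algebraMap (𝓞 L) L x) := rfl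

-- Inertia is defined by its action on 𝓞 L; this extends it to the local ring at w. Write u = n/d
-- with d outside w: the numerator of σu - u is (σn - n)d - n(σd - d), and σd also stays outside w.
omit [NumberField F] in
theorem valuation_inertia_lt_one {w : HeightOneSpectrum (𝓞 L)} {σ : L ≃ₐ[F] L}
    (hσ : σ ∈ w.asIdeal.inertia (L ≃ₐ[F] L)) {u : L} (hu : w.valuation L u ≤ 1) :
    w.valuation L (σ u - u) < 1 := by
  obtain ⟨n, ⟨d, hd'⟩, hd⟩ := exists_primeCompl_mul_eq_of_integer w u hu
  replace hd : u * algebraMap (𝓞 L) L d = algebraMap (𝓞 L) L n := hd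
  replace hd' : d ∉ w.asIdeal := hd'
  have hσd : (σ • d) ∉ w.asIdeal := fun h => hd' (by
    have := w.asIdeal.sub_mem h (hσ d)
    simpa using this)
  have hmem : (σ • n - n) * d - n * (σ • d - d) ∈ w.asIdeal :=
    w.asIdeal.sub_mem (w.asIdeal.mul_mem_right _ (hσ n)) (w.asIdeal.mul_mem_left _ (hσ d))
  have key : algebraMap (𝓞 L) L ((σ • n - n) * d - n * (σ • d - d)) =
      (σ u - u) * algebraMap (𝓞 L) L d * algebraMap (𝓞 L) L (σ • d) := by
    have h1 : algebraMap (𝓞 L) L (σ • n) = σ u * algebraMap (𝓞 L) L (σ • d) := by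
      rw [algebraMap_smul_integer, algebraMap_smul_integer, ← map_mul, hd]
    rw [map_sub, map_mul, map_mul, map_sub, map_sub, h1, ← hd]
    ring
  have h := (valuation_algebraMap_lt_one_iff w _).2 hmem
  rw [key, map_mul, map_mul, (valuation_algebraMap_eq_one_iff w _).2 hd',
    (valuation_algebraMap_eq_one_iff w _).2 hσd, mul_one, mul_one] at h
  exact h

omit [NumberField F] in
/-- An inertia element that scales `u` by a cube root of unity at a prime not above `3` fixes `u`,
provided that some fixed element has the same valuation as `u`. -/
theorem eq_one_of_mem_inertia_of_tame {w : HeightOneSpectrum (𝓞 L)} {σ : L ≃ₐ[F] L}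
    (hσ : σ ∈ w.asIdeal.inertia (L ≃ₐ[F] L)) {z : 𝓞 L} (hz : z ^ 2 + z + 1 = 0)
    (hw : 2 * z + 1 ∉ w.asIdeal) {ω : 𝓞 L} (hω : ω ^ 3 = 1) {u c : L} (hu : u ≠ 0)
    (hσu : σ u = algebraMap (𝓞 L) L ω * u) (hσc : σ c = c)
    (huc : w.valuation L u = w.valuation L c) : ω = 1 := by
  by_contra h1
  obtain ⟨ε, hε⟩ := exists_unit_sub_one_eq hz hω h1
  have hu0 : w.valuation L u ≠ 0 := (Valuation.ne_zero_iff _).2 hu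
  have hdiv : w.valuation L (u / c) = 1 := by rw [map_div₀, ← huc, div_self hu0]
  have := valuation_inertia_lt_one hσ hdiv.le
  rw [map_div₀ σ, hσu, hσc, show algebraMap (𝓞 L) L ω * u / c - u / c =
    algebraMap (𝓞 L) L (ω - 1) * (u / c) by rw [map_sub, map_one]; ring,
    map_mul, hdiv, mul_one, valuation_algebraMap_lt_one_iff, hε] at this
  exact hw ((w.asIdeal.unit_mul_mem_iff_mem ε.isUnit).1 this)

theorem sq_two_mul_add_one {A : Type*} [CommRing A] {z : A} (hz : z ^ 2 + z + 1 = 0) :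
    (2 * z + 1) ^ 2 = -3 := by linear_combination 4 * hz

theorem two_mul_add_one_ne_zero {A : Type*} [CommRing A] [CharZero A] {z : A}
    (hz : z ^ 2 + z + 1 = 0) : 2 * z + 1 ≠ 0 := by
  intro h0
  have h := sq_two_mul_add_one hz
  rw [h0] at h
  have : ((3 : ℕ) : A) = 0 := by push_cast; linear_combination h
  exact absurd this (Nat.cast_ne_zero.2 (by norm_num))

omit [NumberField F] in
/-- An inertia element at a prime above `3` fixes a cube root that is congruent to a fixed
element in the sense of `t ^ 3 ≡ η ^ 3 mod 3√-3`. -/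
theorem eq_one_of_mem_inertia_of_wild {w : HeightOneSpectrum (𝓞 L)} {σ : L ≃ₐ[F] L}
    (hσ : σ ∈ w.asIdeal.inertia (L ≃ₐ[F] L)) {z : 𝓞 L} (hz : z ^ 2 + z + 1 = 0) (hσz : σ • z = z)
    {ω : 𝓞 L} (hω : ω ^ 3 = 1) {t η : 𝓞 L} (ht : t ∉ w.asIdeal)
    (hσt : σ • t = ω * t) (hση : σ • η = η) (h : 3 * (2 * z + 1) ∣ t ^ 3 - η ^ 3) : ω = 1 := by
  by_contra h1
  obtain ⟨ε, hε⟩ := exists_unit_sub_one_eq hz hω h1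
  obtain ⟨c, hc⟩ := h
  have hl2 := sq_two_mul_add_one hz
  have hl0 := two_mul_add_one_ne_zero hz
  have hσl : σ • (2 * z + 1) = 2 * z + 1 := by
    rw [smul_add, smul_mul', hσz, smul_one]
    congr 2
    exact map_ofNat (MulSemiringAction.toRingHom (L ≃ₐ[F] L) (𝓞 L) σ) 2
  generalize 2 * z + 1 = l at *
  obtain ⟨x, hx⟩ : ∃ x, x = (algebraMap (𝓞 L) L t - algebraMap (𝓞 L) L η) / algebraMap (𝓞 L) L l :=
    ⟨_, rfl⟩
  have hl0' : algebraMap (𝓞 L) L l ≠ 0 := by simpa using hl0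
  have htx : algebraMap (𝓞 L) L t = algebraMap (𝓞 L) L l * x + algebraMap (𝓞 L) L η := by
    rw [hx]; field_simp; ring
  have hint : IsIntegral (𝓞 L) x := by
    -- Substitute t = lx + η in t³ - η³ = 3lc and divide by -3l, using l² = -3.
    refine ⟨Polynomial.X ^ 3 - (Polynomial.C (l * η) * Polynomial.X ^ 2 +
      Polynomial.C (η ^ 2) * Polynomial.X - Polynomial.C c), ?_, ?_⟩
    · refine Polynomial.monic_X_pow_sub ?_
      compute_degree!
    · simp only [Polynomial.eval₂_sub, Polynomial.eval₂_add, Polynomial.eval₂_mul,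
        Polynomial.eval₂_pow, Polynomial.eval₂_X, Polynomial.eval₂_C, map_mul, map_pow]
      have hl2' := congrArg (algebraMap (𝓞 L) L) hl2
      have hc' := congrArg (algebraMap (𝓞 L) L) hc
      simp only [map_sub, map_mul, map_pow, map_neg, map_ofNat, htx] at hl2' hc'
      have h3 : (-3 * (algebraMap (𝓞 L) L l)) ≠ 0 := mul_ne_zero (by norm_num) hl0'
      apply mul_left_cancel₀ h3
      linear_combination hc' - (algebraMap (𝓞 L) L l * x ^ 3) * hl2'
  obtain ⟨y, hy⟩ := IsIntegrallyClosed.isIntegral_iff.1 hint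
  have hty : t = l * y + η := by
    apply RingOfIntegers.coe_injective
    rw [map_add, map_mul, hy]
    exact htx
  -- Since σ fixes l and η, l(σy - y) = σt - t = (ω - 1)t. Cancelling l puts a unit times t into w.
  have hmul : l * (σ • y - y) = l * (ε * t) := by
    have e1 : σ • t = l * (σ • y) + η := by
      conv_lhs => rw [hty, smul_add, smul_mul', hσl, hση]
    rw [hσt] at e1
    linear_combination -e1 + t * hε + hty
  have := mul_left_cancel₀ hl0 hmul
  have hm : (ε : 𝓞 L) * t ∈ w.asIdeal := this ▸ hσ y
  exact ht ((w.asIdeal.unit_mul_mem_iff_mem ε.isUnit).1 hm)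

variable [IsGalois F L]

theorem card_inertia_eq_ramificationIdx (w : HeightOneSpectrum (𝓞 L)) :
    Nat.card (w.asIdeal.inertia (L ≃ₐ[F] L)) = w.asIdeal.ramificationIdx (𝓞 F) := by
  have : (w.asIdeal.under (𝓞 F)).IsMaximal := inferInstance
  rw [Ideal.card_inertia_eq_ramificationIdxIn (w.asIdeal.under (𝓞 F)) w.asIdeal,
    Ideal.ramificationIdxIn_eq_ramificationIdx _ w.asIdeal (L ≃ₐ[F] L)]

theorem isUnramifiedAt_of_inertia_eq_bot (w : HeightOneSpectrum (𝓞 L))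
    (h : w.asIdeal.inertia (L ≃ₐ[F] L) = ⊥) : Algebra.IsUnramifiedAt (𝓞 F) w.asIdeal := by
  have : (w.asIdeal.under (𝓞 F)).IsMaximal := inferInstance
  rw [← Ideal.ramificationIdx_eq_one_iff, ← card_inertia_eq_ramificationIdx, h]
  simp

end Inertia

/-! ### Additive valuations at primes -/

section Order

variable {R K : Type*} [CommRing R] [IsDedekindDomain R] [Field K] [Algebra R K]
  [IsFractionRing R K]

/-- The additive valuation of `x : K` at a height one prime. -/
noncomputable def primeOrd (v : HeightOneSpectrum R) (x : K) : ℤ :=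
  FractionalIdeal.count K v (FractionalIdeal.spanSingleton R⁰ x)

theorem primeOrd_mul (v : HeightOneSpectrum R) {x y : K} (hx : x ≠ 0) (hy : y ≠ 0) :
    primeOrd v (x * y) = primeOrd v x + primeOrd v y := by
  rw [primeOrd, ← FractionalIdeal.spanSingleton_mul_spanSingleton, FractionalIdeal.count_mul]
  · rfl
  · exact FractionalIdeal.spanSingleton_ne_zero_iff.2 hx
  · exact FractionalIdeal.spanSingleton_ne_zero_iff.2 hy

theorem primeOrd_pow (v : HeightOneSpectrum R) (x : K) (n : ℕ) :
    primeOrd v (x ^ n) = n * primeOrd v x := by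
  rw [primeOrd, ← FractionalIdeal.spanSingleton_pow, FractionalIdeal.count_pow]
  rfl

theorem primeOrd_inv (v : HeightOneSpectrum R) (x : K) :
    primeOrd v x⁻¹ = - primeOrd v x := by
  rw [primeOrd, ← FractionalIdeal.spanSingleton_inv, FractionalIdeal.count_inv]
  rfl

theorem primeOrd_zpow (v : HeightOneSpectrum R) (x : K) (n : ℤ) :
    primeOrd v (x ^ n) = n * primeOrd v x := by
  cases n with
  | ofNat n => simpa using primeOrd_pow v x n
  | negSucc n => rw [zpow_negSucc, primeOrd_inv, primeOrd_pow, Int.negSucc_eq]; push_cast; ring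

theorem primeOrd_algebraMap (v : HeightOneSpectrum R) {r : R} (hr : r ≠ 0) :
    v.intValuation r = WithZero.exp (-primeOrd v (algebraMap R K r)) := by
  rw [intValuation_if_neg v hr, primeOrd, ← FractionalIdeal.coeIdeal_span_singleton,
    FractionalIdeal.count_coe K v (by simpa using hr)]

theorem valuation_eq_exp_neg_primeOrd (v : HeightOneSpectrum R) {x : K} (hx : x ≠ 0) :
    v.valuation K x = WithZero.exp (-primeOrd v x) := by
  obtain ⟨n, d, hd, rfl⟩ := IsFractionRing.div_surjective (A := R) x
  have hd0 : d ≠ 0 := nonZeroDivisors.ne_zero hd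
  have hn0 : n ≠ 0 := by
    rintro rfl
    simp at hx
  have hn' : algebraMap R K n ≠ 0 := by simpa using hn0
  have hd' : algebraMap R K d ≠ 0 := by simpa using hd0
  rw [map_div₀, valuation_of_algebraMap, valuation_of_algebraMap, primeOrd_algebraMap (K := K) v hn0,
    primeOrd_algebraMap (K := K) v hd0, div_eq_mul_inv,
    div_eq_mul_inv (algebraMap R K n), primeOrd_mul v hn' (inv_ne_zero hd'),
    primeOrd_inv, ← WithZero.exp_neg, ← WithZero.exp_add]
  congr 1
  ring

theorem valuation_eq_iff_primeOrd_eq (v : HeightOneSpectrum R) {x y : K} (hx : x ≠ 0)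
    (hy : y ≠ 0) : v.valuation K x = v.valuation K y ↔ primeOrd v x = primeOrd v y := by
  rw [valuation_eq_exp_neg_primeOrd v hx, valuation_eq_exp_neg_primeOrd v hy, WithZero.exp_inj,
    neg_inj]

theorem exists_primeOrd_eq (v : HeightOneSpectrum R) (m : ℤ) : ∃ z : K, z ≠ 0 ∧ primeOrd v z = m := by
  obtain ⟨p, hp⟩ := v.valuation_exists_uniformizer K
  have hp0 : p ≠ 0 := by
    rintro rfl
    rw [map_zero] at hp
    exact WithZero.exp_ne_zero hp.symm
  refine ⟨p ^ m, zpow_ne_zero m hp0, ?_⟩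
  rw [valuation_eq_exp_neg_primeOrd v hp0, WithZero.exp_inj, neg_inj] at hp
  rw [primeOrd_zpow, hp, mul_one]

theorem primeOrd_algebraMap_nonneg (v : HeightOneSpectrum R) (r : R) :
    0 ≤ primeOrd v (algebraMap R K r) := by
  rw [primeOrd, ← FractionalIdeal.coeIdeal_span_singleton]
  exact FractionalIdeal.count_coe_nonneg K v _

theorem primeOrd_algebraMap_eq_zero_iff (v : HeightOneSpectrum R) {r : R} (hr : r ≠ 0) :
    primeOrd v (algebraMap R K r) = 0 ↔ r ∉ v.asIdeal := by
  have hr' : algebraMap R K r ≠ 0 := by simpa using hr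
  have h := valuation_lt_one_iff_mem (K := K) v r
  have h2 := v.valuation_le_one (K := K) r
  change v.valuation K (algebraMap R K r) < 1 ↔ _ at h
  rw [← h, valuation_eq_exp_neg_primeOrd v hr', ← WithZero.exp_zero, WithZero.exp_lt_exp]
  have := primeOrd_algebraMap_nonneg (K := K) v r
  omega

variable {S L : Type*} [CommRing S] [IsDedekindDomain S] [Field L] [Algebra S L]
  [IsFractionRing S L] [Algebra R S] [Algebra K L] [Algebra R L] [IsScalarTower R K L]
  [IsScalarTower R S L] [Module.IsTorsionFree R S]

theorem primeOrd_liesOver (v : HeightOneSpectrum R) (w : HeightOneSpectrum S)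
    [w.asIdeal.LiesOver v.asIdeal] {x : K} (hx : x ≠ 0) :
    primeOrd w (algebraMap K L x) = w.asIdeal.ramificationIdx R * primeOrd v x := by
  have h := valuation_liesOver L v w x
  have hx' : algebraMap K L x ≠ 0 := by simpa using hx
  rw [valuation_eq_exp_neg_primeOrd v hx, valuation_eq_exp_neg_primeOrd w hx',
    Ideal.ramificationIdx'_eq_ramificationIdx v.asIdeal w.asIdeal v.ne_bot, ← WithZero.exp_nsmul,
    WithZero.exp_inj] at h
  rw [nsmul_eq_mul] at h
  linarith

end Order

/-! ### Inertia acting on the cube root of a primary element -/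

section KummerInertia

variable {F L : Type*} [Field F] [NumberField F] [Field L] [NumberField L] [Algebra F L]

/-- A prime of `L` as a height one prime over its restriction to `F`. -/
def HeightOneSpectrum.restrict (F : Type*) [Field F] [NumberField F] [Algebra F L]
    (w : HeightOneSpectrum (𝓞 L)) : HeightOneSpectrum (𝓞 F) where
  asIdeal := w.asIdeal.under (𝓞 F)
  isPrime := inferInstance
  ne_bot := Ideal.IsIntegral.comap_ne_bot _ w.ne_bot

instance (w : HeightOneSpectrum (𝓞 L)) :
    w.asIdeal.LiesOver (HeightOneSpectrum.restrict F w).asIdeal := ⟨rfl⟩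

omit [NumberField L] in
theorem exists_integer_cube_root_unity {ω : L} (hω : ω ^ 3 = 1) :
    ∃ o : 𝓞 L, algebraMap (𝓞 L) L o = ω ∧ o ^ 3 = 1 := by
  have hi : IsIntegral ℤ ω := IsIntegral.of_pow (n := 3) (by norm_num) (by rw [hω]; exact isIntegral_one)
  obtain ⟨o, rfl⟩ := (IsIntegralClosure.isIntegral_iff (A := 𝓞 L)).1 hi
  refine ⟨o, rfl, RingOfIntegers.coe_injective ?_⟩
  rw [map_pow, map_one]
  exact hω

omit [NumberField F] [NumberField L] in
theorem smul_algebraMap_integer (σ : L ≃ₐ[F] L) (x : 𝓞 F) :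
    σ • algebraMap (𝓞 F) (𝓞 L) x = algebraMap (𝓞 F) (𝓞 L) x :=
  RingOfIntegers.coe_injective (σ.commutes (algebraMap (𝓞 F) F x))

omit [NumberField F] [NumberField L] in
theorem algebraMap_threeSqrtNegThree (ζ : 𝓞 F) :
    algebraMap (𝓞 F) (𝓞 L) (threeSqrtNegThree ζ) = 3 * (2 * algebraMap (𝓞 F) (𝓞 L) ζ + 1) := by
  rw [threeSqrtNegThree, map_mul, map_add, map_mul, map_one, map_ofNat, map_ofNat]

/-- A cube root of a primary π is unramified away from π. Above 3 the wild criterion applies with η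
= 1, because π ≡ 1 mod 3√-3; elsewhere the root is a unit at w, so the tame criterion applies with c
= 1. -/
theorem map_eq_of_mem_inertia_of_cube_eq {ζ : 𝓞 F} (hζ : ζ ^ 2 + ζ + 1 = 0) {π : 𝓞 F}
    (hπ : threeSqrtNegThree ζ ∣ π - 1) {ρ : L}
    (hρ : ρ ^ 3 = algebraMap F L (algebraMap (𝓞 F) F π))
    {w : HeightOneSpectrum (𝓞 L)} (hw : algebraMap (𝓞 F) (𝓞 L) π ∉ w.asIdeal)
    {σ : L ≃ₐ[F] L} (hσ : σ ∈ w.asIdeal.inertia (L ≃ₐ[F] L)) : σ ρ = ρ := by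
  have hi : IsIntegral (𝓞 L) ρ := by
    refine IsIntegral.of_pow (n := 3) (by norm_num) ?_
    rw [hρ]
    exact isIntegral_algebraMap (R := 𝓞 L) (x := algebraMap (𝓞 F) (𝓞 L) π)
  obtain ⟨r, rfl⟩ := IsIntegrallyClosed.isIntegral_iff.1 hi
  have hr : r ^ 3 = algebraMap (𝓞 F) (𝓞 L) π := by
    apply RingOfIntegers.coe_injective
    rw [map_pow, hρ]
    rfl
  have hrw : r ∉ w.asIdeal := fun h => hw (hr ▸ Ideal.pow_mem_of_mem _ h 3 (by norm_num))
  have hz : algebraMap (𝓞 F) (𝓞 L) ζ ^ 2 + algebraMap (𝓞 F) (𝓞 L) ζ + 1 = 0 := by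
    rw [← map_pow, ← map_add, ← map_one (algebraMap (𝓞 F) (𝓞 L)), ← map_add, hζ, map_zero]
  have hcube : (σ (algebraMap (𝓞 L) L r)) ^ 3 = (algebraMap (𝓞 L) L r) ^ 3 := by
    rw [← map_pow, hρ, AlgEquiv.commutes]
  obtain ⟨ω', hω', hσr⟩ := exists_cube_root_unity_mul hcube
  obtain ⟨ω, rfl, hω⟩ := exists_integer_cube_root_unity hω'
  suffices ω = 1 by rw [hσr, this, map_one, one_mul]
  by_cases h3 : 2 * algebraMap (𝓞 F) (𝓞 L) ζ + 1 ∈ w.asIdeal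
  · refine eq_one_of_mem_inertia_of_wild hσ hz (smul_algebraMap_integer σ ζ) hω hrw (η := 1) ?_ (smul_one σ) ?_
    · apply RingOfIntegers.coe_injective
      rw [map_mul]
      exact hσr
    · obtain ⟨c, hc⟩ := hπ
      refine ⟨algebraMap (𝓞 F) (𝓞 L) c, ?_⟩
      rw [hr, one_pow, ← map_one (algebraMap (𝓞 F) (𝓞 L)), ← map_sub, hc, map_mul,
        algebraMap_threeSqrtNegThree, map_one]
  · refine eq_one_of_mem_inertia_of_tame hσ hz h3 hω (c := 1) ?_ hσr (map_one σ) ?_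
    · intro h0
      have : r = 0 := by simpa using h0
      exact hrw (this ▸ w.asIdeal.zero_mem)
    · rw [map_one, valuation_algebraMap_eq_one_iff]
      exact hrw

end KummerInertia

/-! ### Cyclic cubic Kummer extensions and Hilbert 90 -/

section CyclicCubic

variable {k K : Type*} [Field k] [Field K] [Algebra k K] {ζ a : k} {ρ : K} {τ : K ≃ₐ[k] K}

theorem isGalois_of_adjoin_cube_root [CharZero k] (hζ : IsPrimitiveRoot ζ 3)
    (hρ : ρ ^ 3 = algebraMap k K a) (hgen : k⟮ρ⟯ = ⊤) : IsGalois k K := by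
  have hi : IsIntegral k ρ := IsIntegral.of_pow (n := 3) (by norm_num) (by
    rw [hρ]; exact isIntegral_algebraMap)
  have : FiniteDimensional k K := by
    have := IntermediateField.adjoin.finiteDimensional hi
    rw [hgen] at this
    exact IntermediateField.topEquiv.toLinearEquiv.finiteDimensional
  have : Polynomial.IsSplittingField k K (Polynomial.X ^ 3 - Polynomial.C a) := by
    constructor
    · rw [Polynomial.map_sub, Polynomial.map_pow, Polynomial.map_X, Polynomial.map_C]
      exact X_pow_sub_C_splits_of_isPrimitiveRoot
        (hζ.map_of_injective (algebraMap k K).injective) hρ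
    · rw [eq_top_iff, ← IntermediateField.top_toSubalgebra, ← hgen,
        IntermediateField.adjoin_simple_toSubalgebra_of_isAlgebraic hi.isAlgebraic]
      refine Algebra.adjoin_mono (Set.singleton_subset_iff.2 ?_)
      rw [Polynomial.mem_rootSet]
      refine ⟨Polynomial.X_pow_sub_C_ne_zero (by norm_num) a, ?_⟩
      simp [hρ]
  have : Normal k K := Normal.of_isSplittingField (Polynomial.X ^ 3 - Polynomial.C a)
  exact {}

theorem algEquiv_ext_of_adjoin_eq_top {S : Set K} (hgen : IntermediateField.adjoin k S = ⊤)
    {f g : K ≃ₐ[k] K} (h : ∀ x ∈ S, f x = g x) : f = g := by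
  ext x
  have hx : x ∈ IntermediateField.adjoin k S := hgen ▸ IntermediateField.mem_top
  induction hx using IntermediateField.adjoin_induction with
  | mem x hx => exact h x hx
  | algebraMap x => rw [AlgEquiv.commutes, AlgEquiv.commutes]
  | add x y _ _ hx hy => rw [map_add, map_add, hx, hy]
  | inv x _ hx => rw [map_inv₀, map_inv₀, hx]
  | mul x y _ _ hx hy => rw [map_mul, map_mul, hx, hy]

theorem algEquiv_ext_of_adjoin_simple_eq_top (hgen : k⟮ρ⟯ = ⊤) {f g : K ≃ₐ[k] K}
    (h : f ρ = g ρ) : f = g :=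
  algEquiv_ext_of_adjoin_eq_top hgen (by simpa using h)

variable (hζ : ζ ^ 2 + ζ + 1 = 0) (hρ : ρ ^ 3 = algebraMap k K a) (hgen : k⟮ρ⟯ = ⊤)
  (hτ : τ ρ = algebraMap k K ζ * ρ)

include hτ in
theorem cubic_apply_apply : τ (τ ρ) = algebraMap k K (ζ ^ 2) * ρ := by
  rw [hτ, map_mul, AlgEquiv.commutes, hτ, ← mul_assoc, ← map_mul, sq]

include hζ hgen hτ in
theorem cubic_pow_three : τ * τ * τ = 1 := by
  apply algEquiv_ext_of_adjoin_simple_eq_top hgen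
  change τ (τ (τ ρ)) = ρ
  rw [cubic_apply_apply hτ, map_mul, AlgEquiv.commutes, hτ, ← mul_assoc, ← map_mul,
    show ζ ^ 2 * ζ = 1 by linear_combination (ζ - 1) * hζ, map_one, one_mul]

include hζ hρ hgen hτ in
theorem cubic_aut_cases (g : K ≃ₐ[k] K) : g = 1 ∨ g = τ ∨ g = τ * τ := by
  have h3 : (g ρ) ^ 3 = ρ ^ 3 := by rw [← map_pow, hρ, AlgEquiv.commutes]
  obtain ⟨ω, hω, hg⟩ := exists_cube_root_unity_mul h3
  have hz : algebraMap k K ζ ^ 2 + algebraMap k K ζ + 1 = 0 := by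
    rw [← map_pow, ← map_add, ← map_one (algebraMap k K), ← map_add, hζ, map_zero]
  rcases cube_eq_one_cases hz hω with rfl | rfl | rfl
  · exact Or.inl (algEquiv_ext_of_adjoin_simple_eq_top hgen (by rw [hg, one_mul]; rfl))
  · exact Or.inr (Or.inl (algEquiv_ext_of_adjoin_simple_eq_top hgen (by rw [hg, hτ])))
  · refine Or.inr (Or.inr (algEquiv_ext_of_adjoin_simple_eq_top hgen ?_))
    rw [AlgEquiv.mul_apply, cubic_apply_apply hτ, hg, map_pow]

variable [CharZero k]

include hζ hτ in
theorem cubic_distinct (hρ0 : ρ ≠ 0) : τ ≠ 1 ∧ τ * τ ≠ 1 ∧ τ * τ ≠ τ := by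
  have h1 : τ ≠ 1 := by
    rintro rfl
    rw [AlgEquiv.one_apply] at hτ
    have h : algebraMap k K ζ = 1 := mul_right_cancel₀ hρ0 (by rw [← hτ, one_mul])
    rw [← map_one (algebraMap k K)] at h
    have h' := (algebraMap k K).injective h
    rw [h'] at hζ
    norm_num at hζ
  refine ⟨h1, fun h => h1 ?_, fun h => h1 (by simpa using h)⟩
  have h2 : τ (τ ρ) = ρ := DFunLike.congr_fun h ρ
  rw [cubic_apply_apply hτ] at h2
  have h3 : algebraMap k K (ζ ^ 2) = 1 := mul_right_cancel₀ hρ0 (by rw [h2, one_mul])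
  rw [← map_one (algebraMap k K)] at h3
  have h' := (algebraMap k K).injective h3
  have hz1 : ζ = -2 := by linear_combination hζ - h'
  rw [hz1] at h'
  norm_num at h'

include hζ hρ hgen hτ in
theorem cubic_norm_eq [FiniteDimensional k K] [IsGalois k K] (hρ0 : ρ ≠ 0) (x : K) :
    algebraMap k K (Algebra.norm k x) = x * τ x * τ (τ x) := by
  classical
  obtain ⟨h1, h2, h3⟩ := cubic_distinct hζ hτ hρ0
  have hu : (Finset.univ : Finset (K ≃ₐ[k] K)) = {1, τ, τ * τ} := by
    ext g
    simpa using cubic_aut_cases hζ hρ hgen hτ g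
  rw [Algebra.norm_eq_prod_automorphisms, hu, Finset.prod_insert, Finset.prod_insert,
    Finset.prod_singleton]
  · simp [mul_assoc]
  · simpa using h3.symm
  · simpa using ⟨h1.symm, fun h => h2 h.symm⟩

include hζ hρ hgen hτ in
omit [CharZero k] in
theorem cubic_mem_range_of_fixed [FiniteDimensional k K] [IsGalois k K] {x : K} (hx : τ x = x) :
    ∃ b : k, algebraMap k K b = x := by
  rw [← Set.mem_range, ← IntermediateField.mem_bot, IsGalois.mem_bot_iff_fixed]
  intro g
  rcases cubic_aut_cases hζ hρ hgen hτ g with rfl | rfl | rfl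
  · rfl
  · exact hx
  · rw [AlgEquiv.mul_apply, hx, hx]

include hζ hgen hτ in
/-- Hilbert's theorem 90 for a cyclic cubic Kummer extension, by Lagrange resolvents. -/
theorem exists_eq_mul_of_cubic_norm_eq_one {δ : K} (hρ0 : ρ ≠ 0)
    (hδ : δ * τ δ * τ (τ δ) = 1) :
    ∃ κ : K, κ ≠ 0 ∧ τ κ = δ * κ := by
  have hττ : ∀ x, τ (τ (τ x)) = x := fun x => DFunLike.congr_fun (cubic_pow_three hζ hgen hτ) x
  -- The Lagrange resolvent of x; τf = δf follows from τ³ = 1 and δ · τδ · τ²δ = 1.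
  have hρ0' : ∀ x : K, ∃ f : K, f = τ δ * τ (τ δ) * x + τ (τ δ) * τ x + τ (τ x) ∧
      τ f = δ * f := by
    intro x
    refine ⟨_, rfl, ?_⟩
    rw [map_add, map_add, map_mul, map_mul, map_mul, hττ, hττ]
    linear_combination -x * hδ
  by_contra hcon
  push Not at hcon
  have hzero : ∀ x : K, τ δ * τ (τ δ) * x + τ (τ δ) * τ x + τ (τ x) = 0 := by
    intro x
    obtain ⟨f, rfl, hf⟩ := hρ0' x
    by_contra h
    exact hcon _ h hf
  have h0 := hzero 1
  have h1 := hzero ρ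
  have h2 := hzero (ρ ^ 2)
  have hτ2 : τ (τ (ρ ^ 2)) = algebraMap k K ζ * ρ ^ 2 := by
    rw [map_pow, map_pow, cubic_apply_apply hτ, mul_pow, ← map_pow,
      show (ζ ^ 2) ^ 2 = ζ by linear_combination (ζ ^ 2 - ζ) * hζ]
  rw [map_one, map_one] at h0
  rw [cubic_apply_apply hτ, hτ, map_pow] at h1
  rw [hτ2, map_pow, hτ, mul_pow] at h2
  have hz : algebraMap k K ζ ^ 2 + algebraMap k K ζ + 1 = 0 := by
    rw [← map_pow, ← map_add, ← map_one (algebraMap k K), ← map_add, hζ, map_zero]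
  -- If the resolvents of 1, ρ, ρ² all vanished, weighting them by ρ², ρ, 1 and using 1 + ζ + ζ² = 0
  -- would leave only the first coefficient.
  have h3 : (3 : K) * (τ δ * τ (τ δ) * ρ ^ 2) = 0 := by
    linear_combination ρ ^ 2 * h0 + ρ * h1 + h2 - (τ (τ δ) * ρ ^ 2 + ρ ^ 2) * hz
  have : CharZero K := charZero_of_injective_algebraMap (algebraMap k K).injective
  rcases mul_eq_zero.1 h3 with h | h
  · norm_num at h
  · rcases mul_eq_zero.1 h with h | h
    · rw [mul_assoc, h, mul_zero] at hδ
      exact zero_ne_one hδ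
    · exact hρ0 (pow_eq_zero_iff (by norm_num) |>.1 h)

end CyclicCubic

/-! ### Conjugate primes -/

section Conjugate

open scoped Pointwise

variable {k K : Type*} [Field k] [NumberField k] [Field K] [NumberField K] [Algebra k K]

/-- The image of a prime of `K` under an automorphism. -/
def HeightOneSpectrum.conj (σ : K ≃ₐ[k] K) (w : HeightOneSpectrum (𝓞 K)) :
    HeightOneSpectrum (𝓞 K) where
  asIdeal := σ • w.asIdeal
  isPrime := inferInstance
  ne_bot h := w.ne_bot (by
    rw [← inv_smul_smul σ w.asIdeal, h, Ideal.pointwise_smul_def, Ideal.map_bot])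

omit [NumberField k] [NumberField K] in
theorem HeightOneSpectrum.conj_mul (σ τ : K ≃ₐ[k] K) (w : HeightOneSpectrum (𝓞 K)) :
    HeightOneSpectrum.conj (σ * τ) w = HeightOneSpectrum.conj σ (HeightOneSpectrum.conj τ w) :=
  HeightOneSpectrum.ext (mul_smul σ τ w.asIdeal)

omit [NumberField k] [NumberField K] in
theorem HeightOneSpectrum.conj_one (w : HeightOneSpectrum (𝓞 K)) :
    HeightOneSpectrum.conj (1 : K ≃ₐ[k] K) w = w :=
  HeightOneSpectrum.ext (one_smul _ w.asIdeal)

omit [NumberField k] in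
theorem intValuation_conj (σ : K ≃ₐ[k] K) (w : HeightOneSpectrum (𝓞 K)) {r : 𝓞 K} (hr : r ≠ 0) :
    (HeightOneSpectrum.conj σ w).intValuation (σ • r) = w.intValuation r := by
  have hr' : σ • r ≠ 0 := fun h => hr (by simpa using congrArg (σ⁻¹ • ·) h)
  rw [intValuation_eq_exp_neg_multiplicity _ hr, intValuation_eq_exp_neg_multiplicity _ hr']
  have hs : Ideal.span {σ • r} = σ • Ideal.span {r} := by
    rw [Ideal.pointwise_smul_def, Ideal.map_span, Set.image_singleton]
    rfl
  rw [hs]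
  congr 3
  exact multiplicity_map_eq (MulDistribMulAction.toMulEquiv (Ideal (𝓞 K)) σ)

omit [NumberField k] in
theorem primeOrd_conj (σ : K ≃ₐ[k] K) (w : HeightOneSpectrum (𝓞 K)) {x : K} (hx : x ≠ 0) :
    primeOrd (HeightOneSpectrum.conj σ w) (σ x) = primeOrd w x := by
  obtain ⟨n, d, hd, rfl⟩ := IsFractionRing.div_surjective (A := 𝓞 K) x
  have hd0 : d ≠ 0 := nonZeroDivisors.ne_zero hd
  have hn0 : n ≠ 0 := by
    rintro rfl
    simp at hx
  have key : ∀ r : 𝓞 K, r ≠ 0 → primeOrd (HeightOneSpectrum.conj σ w) (algebraMap (𝓞 K) K (σ • r)) =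
      primeOrd w (algebraMap (𝓞 K) K r) := by
    intro r hr
    have hr' : σ • r ≠ 0 := fun h => hr (by simpa using congrArg (σ⁻¹ • ·) h)
    have := intValuation_conj σ w hr
    rwa [primeOrd_algebraMap (K := K) _ hr, primeOrd_algebraMap (K := K) _ hr', WithZero.exp_inj,
      neg_inj] at this
  have hne : ∀ r : 𝓞 K, r ≠ 0 → algebraMap (𝓞 K) K r ≠ 0 := fun r hr => by simpa using hr
  have hσ : ∀ r : 𝓞 K, r ≠ 0 → σ (algebraMap (𝓞 K) K r) ≠ 0 := fun r hr => by simpa using hr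
  rw [map_div₀, div_eq_mul_inv, div_eq_mul_inv, primeOrd_mul _ (hσ n hn0) (inv_ne_zero (hσ d hd0)),
    primeOrd_mul _ (hne n hn0) (inv_ne_zero (hne d hd0)), primeOrd_inv, primeOrd_inv, ← key n hn0,
    ← key d hd0]
  rfl

end Conjugate

theorem IsPrimitiveRoot.sq_add_self_add_one {A : Type*} [CommRing A] [IsDomain A] {ζ : A}
    (h : IsPrimitiveRoot ζ 3) : ζ ^ 2 + ζ + 1 = 0 := by
  have := h.geom_sum_eq_zero (by norm_num)
  simp only [Finset.sum_range_succ, Finset.range_zero, Finset.sum_empty] at this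
  linear_combination this

/-! ### Arithmetic of the Eisenstein integers -/

section Eisenstein

variable {k : Type*} [Field k] [NumberField k]

theorem prime_two_mul_zeta_add_one [IsCyclotomicExtension {3} ℚ k] {ζ : 𝓞 k}
    (hζ : IsPrimitiveRoot ζ 3) : Prime (2 * ζ + 1) := by
  have h3 : Fact (Nat.Prime 3) := ⟨Nat.prime_three⟩
  have hζ' : IsPrimitiveRoot (algebraMap (𝓞 k) k ζ) 3 :=
    hζ.map_of_injective RingOfIntegers.coe_injective
  have hp := hζ'.zeta_sub_one_prime'
  have he : hζ'.toInteger = ζ := RingOfIntegers.coe_injective rfl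
  rw [he] at hp
  obtain ⟨ε, hε⟩ := exists_unit_sub_one_eq hζ.sq_add_self_add_one hζ.pow_eq_one
    (hζ.ne_one (by norm_num))
  rw [hε] at hp
  exact (prime_isUnit_mul ε.isUnit).1 hp

/-- The units are ±ζ^i, and the sign is absorbed by -1 = (-1)³. -/
theorem eisenstein_unit_eq [IsCyclotomicExtension {3} ℚ k] {ζ : 𝓞 k}
    (hζ : IsPrimitiveRoot ζ 3) {u : 𝓞 k} (hu : IsUnit u) :
    ∃ ω s : 𝓞 k, ω ^ 3 = 1 ∧ u = ω * s ^ 3 := by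
  obtain ⟨u, rfl⟩ := hu
  have hζ' : IsPrimitiveRoot (algebraMap (𝓞 k) k ζ) 3 :=
    hζ.map_of_injective RingOfIntegers.coe_injective
  have he : hζ'.toInteger = ζ := RingOfIntegers.coe_injective rfl
  have h := IsCyclotomicExtension.Rat.Three.Units.mem hζ' u
  have h3 := hζ.pow_eq_one
  simp only [List.mem_cons, List.not_mem_nil, or_false] at h
  rcases h with rfl | rfl | rfl | rfl | rfl | rfl
  · exact ⟨1, 1, by simp, by simp⟩
  · exact ⟨1, -1, by simp, by simp; ring⟩
  · exact ⟨ζ, 1, h3, by simp [he]⟩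
  · exact ⟨ζ, -1, h3, by simp [he]; ring⟩
  · exact ⟨ζ ^ 2, 1, by rw [← pow_mul, mul_comm, pow_mul, h3, one_pow], by simp [he]⟩
  · exact ⟨ζ ^ 2, -1, by rw [← pow_mul, mul_comm, pow_mul, h3, one_pow], by simp [he]; ring⟩

end Eisenstein

/-- `K = k(ρ)` with `ρ ^ 3 = π` for a prime element `π ≡ 1 mod 3√-3`, and `τ ρ = ζ ρ`. -/
structure IsPrimaryCubicExtension {k K : Type*} [Field k] [NumberField k] [Field K]
    [NumberField K] [Algebra k K] (ζ π : 𝓞 k) (ρ : K) (τ : K ≃ₐ[k] K) : Prop where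
  zeta : IsPrimitiveRoot ζ 3
  prime : Prime π
  primary : threeSqrtNegThree ζ ∣ π - 1
  cube : ρ ^ 3 = algebraMap k K (algebraMap (𝓞 k) k π)
  adjoin_eq_top : k⟮ρ⟯ = ⊤
  apply_root : τ ρ = algebraMap k K (algebraMap (𝓞 k) k ζ) * ρ

theorem not_mem_of_primary {A : Type*} [CommRing A] {I : Ideal A} (hI : I ≠ ⊤) {l π : A}
    (h : l ∣ π - 1) (hl : l ∈ I) : π ∉ I := by
  intro hπ
  obtain ⟨c, hc⟩ := h
  refine hI ((Ideal.eq_top_iff_one I).2 ?_)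
  rw [show (1 : A) = π - l * c by rw [← hc]; ring]
  exact I.sub_mem hπ (I.mul_mem_right _ hl)

theorem asIdeal_eq_span_of_prime_mem {R : Type*} [CommRing R] [IsDedekindDomain R]
    (v : HeightOneSpectrum R) {p : R} (hp : Prime p) (h : p ∈ v.asIdeal) :
    v.asIdeal = Ideal.span {p} := by
  have : (Ideal.span {p}).IsPrime := (Ideal.span_singleton_prime hp.ne_zero).2 hp
  have hm : (Ideal.span {p}).IsMaximal := this.isMaximal (by simpa using hp.ne_zero)
  exact (hm.eq_of_le v.isPrime.ne_top ((Ideal.span_singleton_le_iff_mem _).2 h)).symm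

theorem primeOrd_self_of_prime {R K : Type*} [CommRing R] [IsDedekindDomain R] [Field K]
    [Algebra R K] [IsFractionRing R K] (v : HeightOneSpectrum R) {p : R} (hp : Prime p)
    (h : p ∈ v.asIdeal) : primeOrd v (algebraMap R K p) = 1 := by
  rw [primeOrd, ← FractionalIdeal.coeIdeal_span_singleton, ← asIdeal_eq_span_of_prime_mem v hp h]
  exact FractionalIdeal.count_self K v

theorem exists_heightOneSpectrum_mem {k K : Type*} [Field k] [NumberField k] [Field K]
    [NumberField K] [Algebra k K] {p : 𝓞 k} (hp : Prime p) :
    ∃ w : HeightOneSpectrum (𝓞 K), algebraMap (𝓞 k) (𝓞 K) p ∈ w.asIdeal := by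
  have hprime : (Ideal.span {p}).IsPrime := (Ideal.span_singleton_prime hp.ne_zero).2 hp
  have hmax : (Ideal.span {p}).IsMaximal := hprime.isMaximal (by simpa using hp.ne_zero)
  obtain ⟨Q, hQ, hQp⟩ :=
    Ideal.exists_maximal_ideal_liesOver_of_isIntegral (S := 𝓞 K) (Ideal.span {p})
  have hpQ : algebraMap (𝓞 k) (𝓞 K) p ∈ Q := by
    rw [← Ideal.mem_of_liesOver Q (Ideal.span {p})]
    exact Ideal.mem_span_singleton_self p
  refine ⟨⟨Q, hQ.isPrime, ?_⟩, hpQ⟩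
  rintro rfl
  exact hp.ne_zero (by simpa using hpQ)

/-! ### The primary cubic extension: ramification and elements of k with orders divisible by 3 -/

namespace IsPrimaryCubicExtension

variable {k K : Type*} [Field k] [NumberField k] [Field K] [NumberField K] [Algebra k K]
  {ζ π : 𝓞 k} {ρ : K} {τ : K ≃ₐ[k] K} (h : IsPrimaryCubicExtension ζ π ρ τ)
include h

theorem zeta_poly : ζ ^ 2 + ζ + 1 = 0 := h.zeta.sq_add_self_add_one

theorem zeta_poly_field : algebraMap (𝓞 k) k ζ ^ 2 + algebraMap (𝓞 k) k ζ + 1 = 0 := by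
  rw [← map_pow, ← map_add, ← map_one (algebraMap (𝓞 k) k), ← map_add, h.zeta_poly, map_zero]

theorem zeta_field : IsPrimitiveRoot (algebraMap (𝓞 k) k ζ) 3 :=
  h.zeta.map_of_injective RingOfIntegers.coe_injective

theorem isGalois : IsGalois k K := isGalois_of_adjoin_cube_root h.zeta_field h.cube h.adjoin_eq_top

theorem root_ne_zero : ρ ≠ 0 := by
  rintro rfl
  have := h.cube
  rw [zero_pow (by norm_num)] at this
  exact h.prime.ne_zero (by simpa using this.symm)

theorem aut_cases (g : K ≃ₐ[k] K) : g = 1 ∨ g = τ ∨ g = τ * τ :=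
  cubic_aut_cases h.zeta_poly_field h.cube h.adjoin_eq_top h.apply_root g

theorem tau_cube : τ * τ * τ = 1 := cubic_pow_three h.zeta_poly_field h.adjoin_eq_top h.apply_root

theorem tau_tau_tau (x : K) : τ (τ (τ x)) = x := DFunLike.congr_fun h.tau_cube x

theorem norm_eq (x : K) : algebraMap k K (Algebra.norm k x) = x * τ x * τ (τ x) := by
  have := h.isGalois
  exact cubic_norm_eq h.zeta_poly_field h.cube h.adjoin_eq_top h.apply_root h.root_ne_zero x

theorem inertia_eq_bot {w : HeightOneSpectrum (𝓞 K)} (hw : algebraMap (𝓞 k) (𝓞 K) π ∉ w.asIdeal) :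
    w.asIdeal.inertia (K ≃ₐ[k] K) = ⊥ := by
  rw [eq_bot_iff]
  intro σ hσ
  have := map_eq_of_mem_inertia_of_cube_eq h.zeta_poly h.primary h.cube hw hσ
  exact algEquiv_ext_of_adjoin_simple_eq_top h.adjoin_eq_top this

theorem primeOrd_algebraMap_eq {w : HeightOneSpectrum (𝓞 K)}
    (hw : algebraMap (𝓞 k) (𝓞 K) π ∉ w.asIdeal) {x : k} (hx : x ≠ 0) :
    primeOrd w (algebraMap k K x) = primeOrd (HeightOneSpectrum.restrict k w) x := by
  have := h.isGalois
  rw [primeOrd_liesOver (HeightOneSpectrum.restrict k w) w hx,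
    ← card_inertia_eq_ramificationIdx (F := k), h.inertia_eq_bot hw]
  simp

theorem not_mem_of_prime {w : HeightOneSpectrum (𝓞 K)} {p : 𝓞 k} (hp : Prime p) (hpπ : ¬ p ∣ π)
    (hw : algebraMap (𝓞 k) (𝓞 K) p ∈ w.asIdeal) : algebraMap (𝓞 k) (𝓞 K) π ∉ w.asIdeal := by
  intro hπ
  have h1 := asIdeal_eq_span_of_prime_mem (HeightOneSpectrum.restrict k w) hp hw
  have h2 : π ∈ (HeightOneSpectrum.restrict k w).asIdeal := hπ
  rw [h1, Ideal.mem_span_singleton] at h2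
  exact hpπ h2

theorem primeOrd_prime {w : HeightOneSpectrum (𝓞 K)} {p : 𝓞 k} (hp : Prime p) (hpπ : ¬ p ∣ π)
    (hw : algebraMap (𝓞 k) (𝓞 K) p ∈ w.asIdeal) :
    primeOrd w (algebraMap k K (algebraMap (𝓞 k) k p)) = 1 := by
  rw [h.primeOrd_algebraMap_eq (h.not_mem_of_prime hp hpπ hw) (by simpa using hp.ne_zero)]
  exact primeOrd_self_of_prime _ hp hw

theorem not_sqrt_dvd [IsCyclotomicExtension {3} ℚ k] : ¬ 2 * ζ + 1 ∣ π := by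
  intro hd
  obtain ⟨c, hc⟩ := h.primary
  have h1 : 2 * ζ + 1 ∣ π - 1 := ⟨3 * c, by rw [hc, threeSqrtNegThree]; ring⟩
  have h2 : 2 * ζ + 1 ∣ 1 := by simpa using dvd_sub hd h1
  exact (prime_two_mul_zeta_add_one h.zeta).not_isUnit (isUnit_of_dvd_one h2)

/-- An element of `k` all of whose valuations in `K` are divisible by `3` is, up to a cube of `K`, a
cube root of unity. -/
theorem integer_eq_root_of_unity_mul_cube [IsCyclotomicExtension {3} ℚ k] (b : 𝓞 k) :
    b ≠ 0 → (∀ w : HeightOneSpectrum (𝓞 K),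
      3 ∣ primeOrd w (algebraMap k K (algebraMap (𝓞 k) k b))) →
    ∃ (ω : 𝓞 k) (c : K), ω ^ 3 = 1 ∧
      algebraMap k K (algebraMap (𝓞 k) k b) = algebraMap k K (algebraMap (𝓞 k) k ω) * c ^ 3 := by
  have hpid := IsCyclotomicExtension.Rat.three_pid k
  have hunit : ∀ u : 𝓞 k, IsUnit u → ∃ (ω : 𝓞 k) (c : K), ω ^ 3 = 1 ∧
      algebraMap k K (algebraMap (𝓞 k) k u) = algebraMap k K (algebraMap (𝓞 k) k ω) * c ^ 3 := by
    intro u hu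
    obtain ⟨ω, s, hω, rfl⟩ := eisenstein_unit_eq h.zeta hu
    exact ⟨ω, algebraMap k K (algebraMap (𝓞 k) k s), hω, by simp only [map_mul, map_pow]⟩
  induction b using UniqueFactorizationMonoid.induction_on_coprime with
  | h0 => exact fun h0 => absurd rfl h0
  | h1 hu => exact fun _ _ => hunit _ hu
  | @hpr p i hp =>
    intro _ hw
    -- A prime associated to π is a unit times the cube ρ³, so no condition on its exponent is
    -- needed. Any other prime is unramified in K, so its exponent is the order at a prime above it
    -- and must be a multiple of 3.
    by_cases hpπ : p ∣ π
    · obtain ⟨u, hu⟩ := hp.associated_of_dvd h.prime hpπ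
      obtain ⟨ω, c, hω, hc⟩ := hunit ((↑u⁻¹ : 𝓞 k) ^ i) (u⁻¹.isUnit.pow i)
      refine ⟨ω, c * ρ ^ i, hω, ?_⟩
      have hpu : p = π * (↑u⁻¹ : 𝓞 k) := by rw [← hu, Units.mul_inv_cancel_right]
      rw [hpu, mul_pow, map_mul, map_mul, hc, mul_pow, ← pow_mul, mul_comm i 3, pow_mul, h.cube,
        map_pow, map_pow]
      ring
    · obtain ⟨w, hpQ⟩ := exists_heightOneSpectrum_mem (K := K) hp
      have h3 := hw w
      rw [map_pow, map_pow, primeOrd_pow, h.primeOrd_prime hp hpπ hpQ, mul_one] at h3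
      obtain ⟨j, rfl⟩ : 3 ∣ i := by exact_mod_cast h3
      refine ⟨1, algebraMap k K (algebraMap (𝓞 k) k p) ^ j, by simp, ?_⟩
      rw [map_pow, map_pow, map_one, map_one, one_mul, ← pow_mul, mul_comm]
  | @hcp x y hxy hx hy =>
    intro hne hw
    have hx0 := left_ne_zero_of_mul hne
    have hy0 := right_ne_zero_of_mul hne
    have hx1 : algebraMap k K (algebraMap (𝓞 k) k x) ≠ 0 := by simpa using hx0
    have hy1 : algebraMap k K (algebraMap (𝓞 k) k y) ≠ 0 := by simpa using hy0
    have hz : ∀ (w : HeightOneSpectrum (𝓞 K)) (r : 𝓞 k), r ≠ 0 →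
        primeOrd w (algebraMap k K (algebraMap (𝓞 k) k r)) = 0 ∨
          algebraMap (𝓞 k) (𝓞 K) r ∈ w.asIdeal := by
      intro w r hr
      by_cases hm : algebraMap (𝓞 k) (𝓞 K) r ∈ w.asIdeal
      · exact Or.inr hm
      · exact Or.inl ((primeOrd_algebraMap_eq_zero_iff (K := K) w (by simpa using hr)).2 hm)
    -- At each prime at most one of the coprime factors has nonzero order, so divisibility by 3
    -- passes to both.
    have hcase : ∀ w : HeightOneSpectrum (𝓞 K),
        primeOrd w (algebraMap k K (algebraMap (𝓞 k) k x)) = 0 ∨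
        primeOrd w (algebraMap k K (algebraMap (𝓞 k) k y)) = 0 := by
      intro w
      rcases hz w x hx0 with h1 | h1
      · exact Or.inl h1
      rcases hz w y hy0 with h2 | h2
      · exact Or.inr h2
      obtain ⟨s, t, hst⟩ := hxy.isCoprime
      refine absurd ((Ideal.eq_top_iff_one w.asIdeal).2 ?_) w.isPrime.ne_top
      rw [← map_one (algebraMap (𝓞 k) (𝓞 K)), ← hst, map_add, map_mul, map_mul]
      exact w.asIdeal.add_mem (w.asIdeal.mul_mem_left _ h1) (w.asIdeal.mul_mem_left _ h2)
    have hsum : ∀ w : HeightOneSpectrum (𝓞 K),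
        3 ∣ primeOrd w (algebraMap k K (algebraMap (𝓞 k) k x)) +
          primeOrd w (algebraMap k K (algebraMap (𝓞 k) k y)) := by
      intro w
      rw [← primeOrd_mul w hx1 hy1, ← map_mul, ← map_mul]
      exact hw w
    obtain ⟨ω, c, hω, hc⟩ := hx hx0 fun w => by
      rcases hcase w with h1 | h1
      · rw [h1]; exact dvd_zero 3
      · simpa [h1] using hsum w
    obtain ⟨ω', c', hω', hc'⟩ := hy hy0 fun w => by
      rcases hcase w with h1 | h1
      · simpa [h1] using hsum w
      · rw [h1]; exact dvd_zero 3
    refine ⟨ω * ω', c * c', by rw [mul_pow, hω, hω', one_mul], ?_⟩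
    rw [map_mul, map_mul, hc, hc', map_mul, map_mul]
    ring

/-- Denominators are harmless: n/d and nd² differ by the cube d³. -/
theorem eq_root_of_unity_mul_cube [IsCyclotomicExtension {3} ℚ k] {b : k} (hb : b ≠ 0)
    (hw : ∀ w : HeightOneSpectrum (𝓞 K), 3 ∣ primeOrd w (algebraMap k K b)) :
    ∃ (ω : 𝓞 k) (c : K), ω ^ 3 = 1 ∧
      algebraMap k K b = algebraMap k K (algebraMap (𝓞 k) k ω) * c ^ 3 := by
  obtain ⟨n, d, hd, rfl⟩ := IsFractionRing.div_surjective (A := 𝓞 k) b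
  have hd0 : d ≠ 0 := nonZeroDivisors.ne_zero hd
  have hn0 : n ≠ 0 := by
    rintro rfl
    simp at hb
  have hd1 : algebraMap (𝓞 k) k d ≠ 0 := by simpa using hd0
  have hd2 : algebraMap k K (algebraMap (𝓞 k) k d) ≠ 0 := by simpa using hd0
  have e : algebraMap (𝓞 k) k (n * d ^ 2) =
      algebraMap (𝓞 k) k n / algebraMap (𝓞 k) k d * algebraMap (𝓞 k) k d ^ 3 := by
    rw [map_mul, map_pow]
    field_simp
  obtain ⟨ω, c, hω, hc⟩ := h.integer_eq_root_of_unity_mul_cube (n * d ^ 2)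
    (mul_ne_zero hn0 (pow_ne_zero 2 hd0)) (fun w => by
      rw [e, map_mul, primeOrd_mul w (by simpa using hb) (by simpa using hd0), map_pow,
        primeOrd_pow]
      exact dvd_add (hw w) (Dvd.intro _ rfl))
  refine ⟨ω, c / algebraMap k K (algebraMap (𝓞 k) k d), hω, ?_⟩
  rw [e, map_mul, map_pow] at hc
  rw [div_pow, ← mul_div_assoc, ← hc]
  field_simp

end IsPrimaryCubicExtension

/-! ### Trivial residue symbol means cube modulo the prime -/

section CubicResidue

variable {k : Type*} [Field k] [NumberField k]

theorem exists_cube_sub_mem {𝔭 : Ideal (𝓞 k)} [h𝔭 : 𝔭.IsMaximal]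
    (hN : Ideal.absNorm 𝔭 ≡ 1 [MOD 3]) {a : 𝓞 k} (ha : a ∉ 𝔭)
    (h : IsCubicResidueSymbol a 𝔭 1) : ∃ b : 𝓞 k, a - b ^ 3 ∈ 𝔭 := by
  have hb : 𝔭 ≠ ⊥ := by
    rintro rfl
    rw [Ideal.absNorm_bot] at hN
    exact absurd hN (by decide)
  let := Ideal.Quotient.field 𝔭
  have : Finite (𝓞 k ⧸ 𝔭) := Ideal.finiteQuotientOfFreeOfNeBot 𝔭 hb
  have hcard : Nat.card (𝓞 k ⧸ 𝔭)ˣ = Ideal.absNorm 𝔭 - 1 := by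
    rw [Nat.card_units, Ideal.absNorm_apply, Submodule.cardQuot_apply]
  have ha' : Ideal.Quotient.mk 𝔭 a ≠ 0 := by rwa [Ne, Ideal.Quotient.eq_zero_iff_mem]
  have hpow : Ideal.Quotient.mk 𝔭 a ^ ((Ideal.absNorm 𝔭 - 1) / 3) = 1 := by
    rw [← map_pow, ← map_one (Ideal.Quotient.mk 𝔭), ← sub_eq_zero, ← map_sub,
      Ideal.Quotient.eq_zero_iff_mem]
    exact h.2
  obtain ⟨g, hg⟩ := IsCyclic.exists_generator (α := (𝓞 k ⧸ 𝔭)ˣ)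
  obtain ⟨n, hn⟩ := hg (Units.mk0 _ ha')
  have hord : orderOf g = Ideal.absNorm 𝔭 - 1 := by
    rw [← hcard, orderOf_eq_card_of_forall_mem_zpowers hg]
  have h1 : 1 < Ideal.absNorm 𝔭 := by
    have h0 : Ideal.absNorm 𝔭 ≠ 0 := Ideal.absNorm_eq_zero_iff.not.2 hb
    have h1 : Ideal.absNorm 𝔭 ≠ 1 := Ideal.absNorm_eq_one_iff.not.2 h𝔭.ne_top
    omega
  obtain ⟨m, hm⟩ : 3 ∣ Ideal.absNorm 𝔭 - 1 := (Nat.modEq_iff_dvd' h1.le).1 hN.symm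
  have hz : g ^ (n * m) = 1 := by
    rw [zpow_mul, zpow_natCast]
    have : (g ^ n : (𝓞 k ⧸ 𝔭)ˣ) = Units.mk0 _ ha' := hn
    rw [this]
    apply Units.ext
    rw [hm, Nat.mul_div_cancel_left _ (by norm_num)] at hpow
    simpa using hpow
  rw [← orderOf_dvd_iff_zpow_eq_one, hord, hm] at hz
  push_cast at hz
  have hm0 : (m : ℤ) ≠ 0 := by
    intro h0
    have : m = 0 := by exact_mod_cast h0
    omega
  -- If a = g^n for a generator g of the cyclic group of order 3m, then a^m = 1 forces 3 ∣ n.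
  obtain ⟨j, rfl⟩ := Int.dvd_of_mul_dvd_mul_right hm0 hz
  obtain ⟨b, hb⟩ := Ideal.Quotient.mk_surjective ((g ^ j : (𝓞 k ⧸ 𝔭)ˣ) : 𝓞 k ⧸ 𝔭)
  refine ⟨b, ?_⟩
  rw [← Ideal.Quotient.eq_zero_iff_mem, map_sub, map_pow, hb, sub_eq_zero]
  have : (g ^ (3 * j) : (𝓞 k ⧸ 𝔭)ˣ) = Units.mk0 _ ha' := hn
  have h3 := congrArg Units.val this
  rw [mul_comm, zpow_mul] at h3
  simpa using h3.symm

end CubicResidue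

/-! ### Splitting of primes and congruences above 3 -/

namespace IsPrimaryCubicExtension

variable {k K : Type*} [Field k] [NumberField k] [Field K] [NumberField K] [Algebra k K]
  {ζ π : 𝓞 k} {ρ : K} {τ : K ≃ₐ[k] K} (h : IsPrimaryCubicExtension ζ π ρ τ)
include h

theorem zeta_poly_integer : algebraMap (𝓞 k) (𝓞 K) ζ ^ 2 + algebraMap (𝓞 k) (𝓞 K) ζ + 1 = 0 := by
  rw [← map_pow, ← map_add, ← map_one (algebraMap (𝓞 k) (𝓞 K)), ← map_add, h.zeta_poly, map_zero]

theorem exists_integer_root :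
    ∃ r : 𝓞 K, algebraMap (𝓞 K) K r = ρ ∧ r ^ 3 = algebraMap (𝓞 k) (𝓞 K) π ∧
      τ • r = algebraMap (𝓞 k) (𝓞 K) ζ * r := by
  have hi : IsIntegral (𝓞 K) ρ := by
    refine IsIntegral.of_pow (n := 3) (by norm_num) ?_
    rw [h.cube]
    exact isIntegral_algebraMap (R := 𝓞 K) (x := algebraMap (𝓞 k) (𝓞 K) π)
  obtain ⟨r, hr⟩ := IsIntegrallyClosed.isIntegral_iff.1 hi
  refine ⟨r, hr, RingOfIntegers.coe_injective ?_, RingOfIntegers.coe_injective ?_⟩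
  · rw [map_pow, hr, h.cube]
    rfl
  · rw [algebraMap_smul_integer, map_mul, hr, h.apply_root]
    rfl

/-- In the residue field at P the root r of π equals ζ^i b for some i. If τ preserved P, applying it
to r - ζ^i b and subtracting would put (ζ - 1)r in P, although p divides neither √-3 nor π. -/
theorem conj_ne_self {p b : 𝓞 k} (hpπ : ¬ p ∣ π) (hp : Prime p) (hpl : ¬ p ∣ 2 * ζ + 1)
    (hb : p ∣ π - b ^ 3) {P : HeightOneSpectrum (𝓞 K)}
    (hP : algebraMap (𝓞 k) (𝓞 K) p ∈ P.asIdeal) : HeightOneSpectrum.conj τ P ≠ P := by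
  intro hconj
  obtain ⟨r, -, hr, hτr⟩ := h.exists_integer_root
  set ι := algebraMap (𝓞 k) (𝓞 K) with hι
  have hmem : ∀ x : 𝓞 K, x ∈ P.asIdeal → τ • x ∈ P.asIdeal := fun x hx => by
    have : τ • x ∈ (HeightOneSpectrum.conj τ P).asIdeal :=
      Ideal.smul_mem_pointwise_smul τ x P.asIdeal hx
    rwa [hconj] at this
  have hz := h.zeta_poly_integer
  rw [← hι] at hz
  have hprod : (r - ι b) * ((r - ι ζ * ι b) * (r - ι (ζ ^ 2) * ι b)) ∈ P.asIdeal := by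
    obtain ⟨c, hc⟩ := hb
    have : (r - ι b) * ((r - ι ζ * ι b) * (r - ι (ζ ^ 2) * ι b)) = ι p * ι c := by
      have hc' := congrArg ι hc
      rw [map_sub, map_mul, map_pow] at hc'
      rw [map_pow]
      linear_combination hr + hc' + (-r ^ 2 * ι b + r * ι b ^ 2 * ι ζ  - ι b ^ 3 * (ι ζ - 1)) * hz
    rw [this]
    exact P.asIdeal.mul_mem_right _ hP
  have hfin : ∀ o : 𝓞 k, r - ι o * ι b ∈ P.asIdeal → False := by
    intro o ho
    have h1 := hmem _ ho
    rw [smul_sub, hτr, smul_mul', smul_algebraMap_integer, smul_algebraMap_integer] at h1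
    have h2 := P.asIdeal.sub_mem h1 ho
    obtain ⟨ε, hε⟩ := exists_unit_sub_one_eq h.zeta_poly h.zeta.pow_eq_one
      (h.zeta.ne_one (by norm_num))
    have h3 : ι ζ * r - ι o * ι b - (r - ι o * ι b) = ι (ζ - 1) * r := by
      rw [map_sub, map_one]; ring
    rw [h3] at h2
    have hspan : P.asIdeal.under (𝓞 k) = Ideal.span {p} :=
      asIdeal_eq_span_of_prime_mem (HeightOneSpectrum.restrict k P) hp hP
    have hdiv : ∀ x : 𝓞 k, ι x ∈ P.asIdeal → p ∣ x := fun x hx => by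
      rw [← Ideal.mem_span_singleton, ← hspan]
      exact hx
    rcases P.isPrime.mem_or_mem h2 with h4 | h4
    · have := hdiv _ h4
      rw [hε] at this
      exact hpl ((Units.dvd_mul_left).1 this)
    · exact hpπ (hdiv _ (hr ▸ P.asIdeal.pow_mem_of_mem h4 3 (by norm_num)))
  rcases P.isPrime.mem_or_mem hprod with h1 | h1
  · exact hfin 1 (by simpa using h1)
  rcases P.isPrime.mem_or_mem h1 with h1 | h1
  · exact hfin ζ h1
  · exact hfin _ h1

theorem conj_tau_tau_tau (P : HeightOneSpectrum (𝓞 K)) :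
    HeightOneSpectrum.conj τ (HeightOneSpectrum.conj τ (HeightOneSpectrum.conj τ P)) = P := by
  rw [← HeightOneSpectrum.conj_mul, ← HeightOneSpectrum.conj_mul, h.tau_cube,
    HeightOneSpectrum.conj_one]

theorem eq_conj_of_mem {p : 𝓞 k} (hp : Prime p) {P w : HeightOneSpectrum (𝓞 K)}
    (hP : algebraMap (𝓞 k) (𝓞 K) p ∈ P.asIdeal) (hw : algebraMap (𝓞 k) (𝓞 K) p ∈ w.asIdeal) :
    w = P ∨ w = HeightOneSpectrum.conj τ P ∨
      w = HeightOneSpectrum.conj τ (HeightOneSpectrum.conj τ P) := by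
  have := h.isGalois
  have h1 : P.asIdeal.under (𝓞 k) = Ideal.span {p} :=
    asIdeal_eq_span_of_prime_mem (HeightOneSpectrum.restrict k P) hp hP
  have h2 : w.asIdeal.under (𝓞 k) = Ideal.span {p} :=
    asIdeal_eq_span_of_prime_mem (HeightOneSpectrum.restrict k w) hp hw
  have : P.asIdeal.LiesOver (Ideal.span {p}) := ⟨h1.symm⟩
  have : w.asIdeal.LiesOver (Ideal.span {p}) := ⟨h2.symm⟩
  obtain ⟨g, hg⟩ :=
    Ideal.exists_smul_eq_of_isGaloisGroup (Ideal.span {p}) P.asIdeal w.asIdeal (K ≃ₐ[k] K)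
  have hw' : w = HeightOneSpectrum.conj g P := HeightOneSpectrum.ext hg.symm
  rw [← HeightOneSpectrum.conj_mul]
  rcases h.aut_cases g with rfl | rfl | rfl
  · exact Or.inl (by rw [hw', HeightOneSpectrum.conj_one])
  · exact Or.inr (Or.inl hw')
  · exact Or.inr (Or.inr hw')

/-- Two cubes that agree modulo `3√-3` up to a cube root of unity `ω` at a prime above `3`
force `ω = 1`. -/
theorem root_of_unity_eq_one_of_congr [IsCyclotomicExtension {3} ℚ k] {w : HeightOneSpectrum (𝓞 K)}
    (hw : algebraMap (𝓞 k) (𝓞 K) (2 * ζ + 1) ∈ w.asIdeal) {ω A B : 𝓞 K} (hω : ω ^ 3 = 1)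
    (hB : B ∉ w.asIdeal)
    (hAB : algebraMap (𝓞 k) (𝓞 K) (threeSqrtNegThree ζ) ∣ A ^ 3 - ω * B ^ 3) : ω = 1 := by
  by_contra h1
  obtain ⟨ε, hε⟩ := exists_unit_sub_one_eq h.zeta_poly_integer hω h1
  have hl : 2 * algebraMap (𝓞 k) (𝓞 K) ζ + 1 = algebraMap (𝓞 k) (𝓞 K) (2 * ζ + 1) := by
    rw [map_add, map_mul, map_one, map_ofNat]
  have hl2 := sq_two_mul_add_one h.zeta_poly_integer
  have hord := h.primeOrd_prime (prime_two_mul_zeta_add_one h.zeta) h.not_sqrt_dvd hw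
  obtain ⟨c, hc⟩ := hAB
  rw [algebraMap_threeSqrtNegThree] at hc
  rw [hl] at hε hl2 hc
  have hl0 : algebraMap (𝓞 k) (𝓞 K) (2 * ζ + 1) ≠ 0 := by
    rw [← hl]; exact two_mul_add_one_ne_zero h.zeta_poly_integer
  have hordl : primeOrd w (algebraMap (𝓞 K) K (algebraMap (𝓞 k) (𝓞 K) (2 * ζ + 1))) = 1 := hord
  generalize algebraMap (𝓞 k) (𝓞 K) (2 * ζ + 1) = l at *
  have hd : (A - B) ^ 3 = l * (-l ^ 2 * c + ε * B ^ 3 + l * A * B * (A - B)) := by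
    linear_combination hc + B ^ 3 * hε + (l * c - A * B * (A - B)) * hl2
  have hAB' : A - B ∈ w.asIdeal := by
    refine w.isPrime.mem_of_pow_mem 3 ?_
    rw [hd]
    exact w.asIdeal.mul_mem_right _ hw
  -- The identity for (A - B)³ forces A - B into w, and then every term other than lεB³ lies in w².
  -- But l has order exactly 1, since K/k is unramified there, and εB³ is a unit at w.
  have hmem : (l : 𝓞 K) * (ε * B ^ 3) ∈ w.asIdeal ^ 2 := by
    have e : l * (ε * B ^ 3) = (A - B) ^ 2 * (A - B) + l ^ 2 * (l * c - A * B * (A - B)) := by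
      linear_combination -hd
    rw [e]
    exact Ideal.add_mem _ (Ideal.mul_mem_right _ _ (Ideal.pow_mem_pow hAB' 2))
      (Ideal.mul_mem_right _ _ (Ideal.pow_mem_pow hw 2))
  have hunit : (ε : 𝓞 K) * B ^ 3 ∉ w.asIdeal := fun hm =>
    hB (w.isPrime.mem_of_pow_mem 3 ((w.asIdeal.unit_mul_mem_iff_mem ε.isUnit).1 hm))
  have hu0 : (ε : 𝓞 K) * B ^ 3 ≠ 0 := fun h0 => hunit (h0 ▸ w.asIdeal.zero_mem)
  have hordu := (primeOrd_algebraMap_eq_zero_iff (K := K) w hu0).2 hunit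
  rw [← intValuation_le_pow_iff_mem, primeOrd_algebraMap (K := K) w (mul_ne_zero hl0 hu0), map_mul,
    primeOrd_mul w (by simpa using hl0) (by simpa using hu0), hordl, hordu, WithZero.exp_le_exp] at hmem
  norm_num at hmem

end IsPrimaryCubicExtension

/-- The cubic extension `K = k(ρ)` together with a second primary prime `π₂` of `k` modulo which
`π₁` is a cube, a prime `P` of `K` over `π₂`, and an admissible integer `θ`. -/
structure IsAdmissibleDatum {k K : Type*} [Field k] [NumberField k] [Field K]
    [NumberField K] [Algebra k K] (ζ π₁ π₂ : 𝓞 k) (ρ : K) (τ : K ≃ₐ[k] K)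
    (P : HeightOneSpectrum (𝓞 K)) (θ : 𝓞 K) : Prop extends
    IsPrimaryCubicExtension ζ π₁ ρ τ where
  prime₂ : Prime π₂
  primary₂ : threeSqrtNegThree ζ ∣ π₂ - 1
  not_dvd : ¬ π₂ ∣ π₁
  cube_residue : ∃ b, π₂ ∣ π₁ - b ^ 3
  mem : algebraMap (𝓞 k) (𝓞 K) π₂ ∈ P.asIdeal
  admissible : IsAdmissible ζ π₂ τ P.asIdeal θ

theorem count_eq_zero_of_not_dvd {R K : Type*} [CommRing R] [IsDedekindDomain R] [Field K]
    [Algebra R K] [IsFractionRing R K] (v : HeightOneSpectrum R) {J : Ideal R} (hJ : J ≠ 0)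
    (h : ¬ v.asIdeal ∣ J) : FractionalIdeal.count K v (J : FractionalIdeal R⁰ K) = 0 := by
  classical
  rw [FractionalIdeal.count_coe K v hJ, Nat.cast_eq_zero]
  by_contra h0
  exact h ((Associates.count_ne_zero_iff_dvd hJ v.irreducible).1 h0)

/-! ### Orders of θ and of its conjugates -/

namespace IsAdmissibleDatum

variable {k K : Type*} [Field k] [NumberField k] [Field K] [NumberField K] [Algebra k K]
  {ζ π₁ π₂ : 𝓞 k} {ρ : K} {τ : K ≃ₐ[k] K} {P : HeightOneSpectrum (𝓞 K)} {θ : 𝓞 K}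
  (h : IsAdmissibleDatum ζ π₁ π₂ ρ τ P θ)
include h

theorem pi_two_ne_zero : algebraMap k K (algebraMap (𝓞 k) k π₂) ≠ 0 := by
  simpa using h.prime₂.ne_zero

theorem sqrt_not_mem_of_mem {w : HeightOneSpectrum (𝓞 K)}
    (hw : algebraMap (𝓞 k) (𝓞 K) π₂ ∈ w.asIdeal) :
    algebraMap (𝓞 k) (𝓞 K) (2 * ζ + 1) ∉ w.asIdeal := by
  intro hl
  obtain ⟨c, hc⟩ := h.primary₂
  refine not_mem_of_primary w.isPrime.ne_top (l := algebraMap (𝓞 k) (𝓞 K) (2 * ζ + 1)) ?_ hl hw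
  refine ⟨algebraMap (𝓞 k) (𝓞 K) (3 * c), ?_⟩
  rw [← map_one (algebraMap (𝓞 k) (𝓞 K)), ← map_sub, hc, ← map_mul, threeSqrtNegThree]
  congr 1
  ring

theorem three_mem_of_sqrt_mem {w : HeightOneSpectrum (𝓞 K)}
    (hl : algebraMap (𝓞 k) (𝓞 K) (2 * ζ + 1) ∈ w.asIdeal) : (3 : 𝓞 K) ∈ w.asIdeal := by
  have e : (3 : 𝓞 K) = -(algebraMap (𝓞 k) (𝓞 K) (2 * ζ + 1)) ^ 2 := by
    rw [← map_pow, sq_two_mul_add_one h.zeta_poly, map_neg, neg_neg, map_ofNat]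
  rw [e]
  exact w.asIdeal.neg_mem (w.asIdeal.pow_mem_of_mem hl 2 (by norm_num))

theorem not_le_of_isCoprime_three {A : Ideal (𝓞 K)} (hA : IsCoprime A (Ideal.span {3}))
    {w : HeightOneSpectrum (𝓞 K)} (hl : algebraMap (𝓞 k) (𝓞 K) (2 * ζ + 1) ∈ w.asIdeal) :
    ¬ A ≤ w.asIdeal := by
  intro hle
  rw [Ideal.isCoprime_iff_sup_eq] at hA
  refine w.isPrime.ne_top (top_le_iff.1 (hA ▸ sup_le hle ?_))
  rw [Ideal.span_singleton_le_iff_mem]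
  exact h.three_mem_of_sqrt_mem hl

/-- Some prime lies above 3, so the zero ideal is not prime to 3. This legitimates the integer
powers of 𝔄 and yields θ ≠ 0. -/
theorem ne_zero_of_isCoprime_three [IsCyclotomicExtension {3} ℚ k] {A : Ideal (𝓞 K)}
    (hA : IsCoprime A (Ideal.span {3})) : A ≠ 0 := by
  rintro rfl
  obtain ⟨w, hw⟩ := exists_heightOneSpectrum_mem (K := K) (prime_two_mul_zeta_add_one h.zeta)
  exact h.not_le_of_isCoprime_three hA hw bot_le

theorem exists_primeOrd_theta_eq [IsCyclotomicExtension {3} ℚ k] :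
    algebraMap (𝓞 K) K θ ≠ 0 ∧ ∃ (e a : ℤ) (A : Ideal (𝓞 K)), IsCoprime e 3 ∧
      IsCoprime A (Ideal.span {3}) ∧ 3 ∣ a ∧
      ∀ w : HeightOneSpectrum (𝓞 K), primeOrd w (algebraMap (𝓞 K) K θ) =
        2 * e * FractionalIdeal.count K w (P.asIdeal : FractionalIdeal (𝓞 K)⁰ K) +
        e * FractionalIdeal.count K w
          ((HeightOneSpectrum.conj τ P).asIdeal : FractionalIdeal (𝓞 K)⁰ K) +
        a * FractionalIdeal.count K w (A : FractionalIdeal (𝓞 K)⁰ K) := by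
  obtain ⟨e, a, A, he, hA, ha, hfac⟩ := h.admissible.factorization
  change FractionalIdeal.spanSingleton (𝓞 K)⁰ (algebraMap (𝓞 K) K θ) =
    (P.asIdeal : FractionalIdeal (𝓞 K)⁰ K) ^ (2 * e) *
    ((HeightOneSpectrum.conj τ P).asIdeal : FractionalIdeal (𝓞 K)⁰ K) ^ e *
    (A : FractionalIdeal (𝓞 K)⁰ K) ^ a at hfac
  have hP : (P.asIdeal : FractionalIdeal (𝓞 K)⁰ K) ≠ 0 := by simpa using P.ne_bot
  have hQ : ((HeightOneSpectrum.conj τ P).asIdeal : FractionalIdeal (𝓞 K)⁰ K) ≠ 0 := by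
    simpa using (HeightOneSpectrum.conj τ P).ne_bot
  have hA0 : (A : FractionalIdeal (𝓞 K)⁰ K) ≠ 0 := by
    simpa using h.ne_zero_of_isCoprime_three hA
  have hPe := zpow_ne_zero (2 * e) hP
  have hQe := zpow_ne_zero e hQ
  have hAa := zpow_ne_zero a hA0
  refine ⟨fun h0 => mul_ne_zero (mul_ne_zero hPe hQe) hAa ?_, e, a, A, he, hA, ha, fun w => ?_⟩
  · rw [← hfac, h0, FractionalIdeal.spanSingleton_zero]
  · rw [primeOrd, hfac, FractionalIdeal.count_mul K w (mul_ne_zero hPe hQe) hAa,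
      FractionalIdeal.count_mul K w hPe hQe, FractionalIdeal.count_zpow,
      FractionalIdeal.count_zpow, FractionalIdeal.count_zpow]

theorem theta_ne_zero [IsCyclotomicExtension {3} ℚ k] : algebraMap (𝓞 K) K θ ≠ 0 :=
  h.exists_primeOrd_theta_eq.1

theorem mem_conj {w : HeightOneSpectrum (𝓞 K)} (hw : algebraMap (𝓞 k) (𝓞 K) π₂ ∈ w.asIdeal) :
    algebraMap (𝓞 k) (𝓞 K) π₂ ∈ (HeightOneSpectrum.conj τ w).asIdeal := by
  rw [← smul_algebraMap_integer τ]
  open scoped Pointwise in exact Ideal.smul_mem_pointwise_smul τ _ w.asIdeal hw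

/-- Modulo 3 the factor 𝔄^a disappears. Above 3 the order vanishes exactly, since P, τP and 𝔄 are
all prime to 3. -/
theorem primeOrd_theta [IsCyclotomicExtension {3} ℚ k] : ∃ e : ℤ, IsCoprime e 3 ∧
    (∀ w : HeightOneSpectrum (𝓞 K), algebraMap (𝓞 k) (𝓞 K) (2 * ζ + 1) ∈ w.asIdeal →
      primeOrd w (algebraMap (𝓞 K) K θ) = 0) ∧
    (∀ w : HeightOneSpectrum (𝓞 K), w ≠ P → w ≠ HeightOneSpectrum.conj τ P →
      3 ∣ primeOrd w (algebraMap (𝓞 K) K θ)) ∧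
    (∀ w : HeightOneSpectrum (𝓞 K), w = P → w ≠ HeightOneSpectrum.conj τ P →
      3 ∣ primeOrd w (algebraMap (𝓞 K) K θ) - 2 * e) ∧
    (∀ w : HeightOneSpectrum (𝓞 K), w ≠ P → w = HeightOneSpectrum.conj τ P →
      3 ∣ primeOrd w (algebraMap (𝓞 K) K θ) - e) := by
  classical
  obtain ⟨-, e, a, A, he, hA, ⟨m, rfl⟩, hord⟩ := h.exists_primeOrd_theta_eq
  simp only [FractionalIdeal.count_maximal] at hord
  refine ⟨e, he, fun w hl => ?_, fun w h1 h2 => ?_, fun w h1 h2 => ?_, fun w h1 h2 => ?_⟩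
  · have hP : P ≠ w := by
      rintro rfl
      exact h.sqrt_not_mem_of_mem h.mem hl
    have hQ : HeightOneSpectrum.conj τ P ≠ w := by
      rintro rfl
      exact h.sqrt_not_mem_of_mem (h.mem_conj h.mem) hl
    rw [hord w, if_neg hP, if_neg hQ, count_eq_zero_of_not_dvd w (h.ne_zero_of_isCoprime_three hA)
      (fun hd => h.not_le_of_isCoprime_three hA hl (Ideal.le_of_dvd hd))]
    ring
  · rw [hord w, if_neg h1.symm, if_neg h2.symm]
    exact ⟨m * FractionalIdeal.count K w (A : FractionalIdeal (𝓞 K)⁰ K), by ring⟩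
  · rw [hord w, if_pos h1.symm, if_neg h2.symm]
    exact ⟨m * FractionalIdeal.count K w (A : FractionalIdeal (𝓞 K)⁰ K), by ring⟩
  · rw [hord w, if_neg h1.symm, if_pos h2.symm]
    exact ⟨m * FractionalIdeal.count K w (A : FractionalIdeal (𝓞 K)⁰ K), by ring⟩

theorem primeOrd_apply (w : HeightOneSpectrum (𝓞 K)) {x : K} (hx : x ≠ 0) :
    primeOrd w (τ x) = primeOrd (HeightOneSpectrum.conj τ (HeightOneSpectrum.conj τ w)) x := by
  rw [← primeOrd_conj τ _ hx, h.conj_tau_tau_tau]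

theorem conj_ne_self_of_mem {w : HeightOneSpectrum (𝓞 K)}
    (hw : algebraMap (𝓞 k) (𝓞 K) π₂ ∈ w.asIdeal) : HeightOneSpectrum.conj τ w ≠ w := by
  obtain ⟨b, hb⟩ := h.cube_residue
  refine h.conj_ne_self h.not_dvd h.prime₂ (fun hd => ?_) hb hw
  obtain ⟨c, hc⟩ := hd
  refine h.sqrt_not_mem_of_mem hw ?_
  rw [hc, map_mul]
  exact w.asIdeal.mul_mem_right _ hw

theorem conj_conj_ne_self_of_mem {w : HeightOneSpectrum (𝓞 K)}
    (hw : algebraMap (𝓞 k) (𝓞 K) π₂ ∈ w.asIdeal) :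
    HeightOneSpectrum.conj τ (HeightOneSpectrum.conj τ w) ≠ w := by
  intro hc
  apply h.conj_ne_self_of_mem hw
  conv_lhs => rw [← hc]
  exact h.conj_tau_tau_tau w

theorem three_dvd_primeOrd_theta [IsCyclotomicExtension {3} ℚ k] {w : HeightOneSpectrum (𝓞 K)}
    (hw : algebraMap (𝓞 k) (𝓞 K) π₂ ∉ w.asIdeal) : 3 ∣ primeOrd w (algebraMap (𝓞 K) K θ) := by
  obtain ⟨e, -, -, h0, -, -⟩ := h.primeOrd_theta
  refine h0 w ?_ ?_
  · rintro rfl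
    exact hw h.mem
  · rintro rfl
    exact hw (h.mem_conj h.mem)

/-- Write Q = τP and R = τ²P. Up to cubes, (τθ/θ) = Q^(2e) R^e / (P^(2e) Q^e), whose exponents -2e,
e, e are all congruent to e modulo 3. At P, Q and R the order of π₂ is 1; at every other prime both
θ and τθ have order divisible by 3. -/
theorem three_dvd_primeOrd_quotient [IsCyclotomicExtension {3} ℚ k] : ∃ e : ℤ, IsCoprime e 3 ∧
    ∀ w : HeightOneSpectrum (𝓞 K), 3 ∣ primeOrd w (τ (algebraMap (𝓞 K) K θ)) -
      primeOrd w (algebraMap (𝓞 K) K θ) -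
      e * primeOrd w (algebraMap k K (algebraMap (𝓞 k) k π₂)) := by
  obtain ⟨e, he, -, h0, hP, hQ⟩ := h.primeOrd_theta
  refine ⟨e, he, fun w => ?_⟩
  have hne1 := h.conj_ne_self_of_mem h.mem
  have hne2 := h.conj_conj_ne_self_of_mem h.mem
  have hne3 := h.conj_ne_self_of_mem (h.mem_conj h.mem)
  rw [h.primeOrd_apply w h.theta_ne_zero]
  have h1 := hP P rfl hne1.symm
  have h2 := hQ _ hne1 rfl
  have h3 := h0 _ hne2 hne3
  by_cases hw : algebraMap (𝓞 k) (𝓞 K) π₂ ∈ w.asIdeal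
  · rw [h.primeOrd_prime h.prime₂ h.not_dvd hw]
    rcases h.eq_conj_of_mem h.prime₂ h.mem hw with rfl | rfl | rfl
    · omega
    · rw [h.conj_tau_tau_tau]
      omega
    · rw [h.conj_tau_tau_tau]
      omega
  · have hw0 : primeOrd w (algebraMap k K (algebraMap (𝓞 k) k π₂)) = 0 :=
      (primeOrd_algebraMap_eq_zero_iff (K := K) w (by simpa using h.prime₂.ne_zero)).2 hw
    have hw' : algebraMap (𝓞 k) (𝓞 K) π₂ ∉
        (HeightOneSpectrum.conj τ (HeightOneSpectrum.conj τ w)).asIdeal := fun hm => hw (by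
      have := h.mem_conj hm
      rwa [h.conj_tau_tau_tau] at this)
    rw [hw0]
    have h4 := h.three_dvd_primeOrd_theta hw
    have h5 := h.three_dvd_primeOrd_theta hw'
    omega

/-- Otherwise the order of τθ/θ at P would be 0, contradicting its congruence to e modulo 3. This is
what makes θ generate K over k. -/
theorem apply_theta_ne [IsCyclotomicExtension {3} ℚ k] :
    τ (algebraMap (𝓞 K) K θ) ≠ algebraMap (𝓞 K) K θ := by
  intro heq
  obtain ⟨e, ⟨x, y, hxy⟩, hd⟩ := h.three_dvd_primeOrd_quotient
  have := hd P
  rw [heq, h.primeOrd_prime h.prime₂ h.not_dvd h.mem] at this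
  have h3 : (3 : ℤ) ∣ e := by omega
  obtain ⟨m, rfl⟩ := h3
  have : (3 : ℤ) ∣ 1 := ⟨x * m + y, by linear_combination -hxy⟩
  omega

end IsAdmissibleDatum

/-! ### The relation between τθ and θ -/

namespace IsAdmissibleDatum

variable {k K : Type*} [Field k] [NumberField k] [Field K] [NumberField K] [Algebra k K]
  {ζ π₁ π₂ : 𝓞 k} {ρ : K} {τ : K ≃ₐ[k] K} {P : HeightOneSpectrum (𝓞 K)} {θ : 𝓞 K}
  (h : IsAdmissibleDatum ζ π₁ π₂ ρ τ P θ)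
include h

theorem theta_not_mem [IsCyclotomicExtension {3} ℚ k] {w : HeightOneSpectrum (𝓞 K)}
    (hl : algebraMap (𝓞 k) (𝓞 K) (2 * ζ + 1) ∈ w.asIdeal) : θ ∉ w.asIdeal := by
  obtain ⟨-, -, h0, -⟩ := h.primeOrd_theta
  have hθ : θ ≠ 0 := fun h0 => h.theta_ne_zero (by rw [h0, map_zero])
  exact (primeOrd_algebraMap_eq_zero_iff (K := K) w hθ).1 (h0 w hl)

/-- At a prime w above √-3, both θ and τθ are units, hence so is y. Modulo 3√-3 they are the cubes
η³ and (τη)³, and π₂ ≡ 1, so the relation compares ω with a quotient of cubes. -/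
theorem root_of_unity_eq_one [IsCyclotomicExtension {3} ℚ k] {ω : 𝓞 K} (hω : ω ^ 3 = 1) {n : ℕ}
    {y : K} (hy : τ (algebraMap (𝓞 K) K θ) = algebraMap (𝓞 K) K ω * (algebraMap (𝓞 K) K θ *
      algebraMap k K (algebraMap (𝓞 k) k π₂) ^ n * y ^ 3)) : ω = 1 := by
  obtain ⟨w, hw⟩ := exists_heightOneSpectrum_mem (K := K) (prime_two_mul_zeta_add_one h.zeta)
  have hθ := h.theta_not_mem hw
  have hτw : algebraMap (𝓞 k) (𝓞 K) (2 * ζ + 1) ∈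
      (HeightOneSpectrum.conj τ (HeightOneSpectrum.conj τ w)).asIdeal := by
    have : ∀ w : HeightOneSpectrum (𝓞 K), algebraMap (𝓞 k) (𝓞 K) (2 * ζ + 1) ∈ w.asIdeal →
        algebraMap (𝓞 k) (𝓞 K) (2 * ζ + 1) ∈ (HeightOneSpectrum.conj τ w).asIdeal := by
      intro w hw
      rw [← smul_algebraMap_integer τ]
      open scoped Pointwise in exact Ideal.smul_mem_pointwise_smul τ _ w.asIdeal hw
    exact this _ (this _ hw)
  obtain ⟨-, -, h0, -⟩ := h.primeOrd_theta
  have hτθ0 : τ (algebraMap (𝓞 K) K θ) ≠ 0 := by simpa using h.theta_ne_zero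
  have hy0 : y ≠ 0 := by
    rintro rfl
    exact hτθ0 (by rw [hy]; ring)
  have hω0 : ω ≠ 0 := by
    rintro rfl
    norm_num at hω
  have hω1 : primeOrd w (algebraMap (𝓞 K) K ω) = 0 := by
    have := primeOrd_pow w (algebraMap (𝓞 K) K ω) 3
    rw [← map_pow, hω, (primeOrd_algebraMap_eq_zero_iff (K := K) w one_ne_zero).2
      (fun h1 => w.isPrime.ne_top ((Ideal.eq_top_iff_one _).2 h1))] at this
    push_cast at this
    omega
  have hπ : primeOrd w (algebraMap k K (algebraMap (𝓞 k) k π₂)) = 0 :=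
    (primeOrd_algebraMap_eq_zero_iff (K := K) w (by simpa using h.prime₂.ne_zero)).2
      (fun hm => h.sqrt_not_mem_of_mem hm hw)
  have hordy : primeOrd w y = 0 := by
    have e := congrArg (primeOrd w) hy
    have hπn := pow_ne_zero n h.pi_two_ne_zero
    rw [h.primeOrd_apply w h.theta_ne_zero, h0 _ hτw, primeOrd_mul w (by simpa using hω0)
      (mul_ne_zero (mul_ne_zero h.theta_ne_zero hπn) (pow_ne_zero 3 hy0)),
      primeOrd_mul w (mul_ne_zero h.theta_ne_zero hπn) (pow_ne_zero 3 hy0),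
      primeOrd_mul w h.theta_ne_zero hπn, primeOrd_pow, primeOrd_pow, hω1, h0 w hw, hπ] at e
    push_cast at e
    omega
  have hvy : w.valuation K y = 1 := by
    rw [valuation_eq_exp_neg_primeOrd w hy0, hordy, neg_zero, WithZero.exp_zero]
  obtain ⟨N, ⟨d, hd⟩, hNd⟩ := exists_primeCompl_mul_eq_of_integer w y hvy.le
  replace hNd : y * algebraMap (𝓞 K) K d = algebraMap (𝓞 K) K N := hNd
  replace hd : d ∉ w.asIdeal := hd
  have hN : N ∉ w.asIdeal := by
    rw [← valuation_algebraMap_eq_one_iff, ← hNd, map_mul, hvy, one_mul,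
      valuation_algebraMap_eq_one_iff]
    exact hd
  have hrel : d ^ 3 * (τ • θ) = ω * (θ * algebraMap (𝓞 k) (𝓞 K) π₂ ^ n * N ^ 3) := by
    apply RingOfIntegers.coe_injective
    have e : algebraMap (𝓞 K) K (algebraMap (𝓞 k) (𝓞 K) π₂) =
      algebraMap k K (algebraMap (𝓞 k) k π₂) := rfl
    rw [map_mul, map_pow, algebraMap_smul_integer, hy, map_mul, map_mul, map_mul, map_pow, map_pow,
      ← hNd, e]
    ring
  obtain ⟨η, hη⟩ := h.admissible.cube_congr
  rw [Ideal.mem_span_singleton] at hη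
  set D := algebraMap (𝓞 k) (𝓞 K) (threeSqrtNegThree ζ) with hD
  have hDw : D ∈ w.asIdeal := by
    rw [hD, threeSqrtNegThree, map_mul]
    exact w.asIdeal.mul_mem_left _ hw
  have hητ : D ∣ (τ • η) ^ 3 - τ • θ := by
    obtain ⟨c, hc⟩ := hη
    refine ⟨τ • c, ?_⟩
    have := congrArg (τ • ·) hc
    simpa only [smul_sub, smul_pow', smul_mul', hD, smul_algebraMap_integer] using this
  have hπD : D ∣ algebraMap (𝓞 k) (𝓞 K) π₂ ^ n - 1 := by
    have h1 : D ∣ algebraMap (𝓞 k) (𝓞 K) π₂ - 1 := by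
      have := map_dvd (algebraMap (𝓞 k) (𝓞 K)) h.primary₂
      rwa [map_sub, map_one] at this
    exact h1.trans (sub_one_dvd_pow_sub_one _ n)
  have hηw : η ∉ w.asIdeal := by
    intro hm
    obtain ⟨c, hc⟩ := hη
    apply hθ
    rw [show θ = η ^ 3 - D * c by rw [← hc]; ring]
    exact w.asIdeal.sub_mem (w.asIdeal.pow_mem_of_mem hm 3 (by norm_num))
      (w.asIdeal.mul_mem_right _ hDw)
  -- With y = N/d, clearing denominators gives (d · τη)³ ≡ d³ · τθ = ωθπ₂^n N³ ≡ ω(Nη)³.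
  refine h.root_of_unity_eq_one_of_congr hw hω (A := d * τ • η) (B := N * η)
    (fun hm => (w.isPrime.mem_or_mem hm).elim hN hηw) ?_
  have e : (d * τ • η) ^ 3 - ω * (N * η) ^ 3 = d ^ 3 * ((τ • η) ^ 3 - τ • θ) +
      (ω * N ^ 3 * θ * (algebraMap (𝓞 k) (𝓞 K) π₂ ^ n - 1) - ω * N ^ 3 * (η ^ 3 - θ)) := by
    linear_combination hrel
  rw [e]
  exact dvd_add (hητ.mul_left _) (dvd_sub (hπD.mul_left _) (hη.mul_left _))

/-- The key relation: up to cubes, `τ θ / θ` is a nontrivial power of `π₂`. -/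
theorem exists_apply_theta_eq [IsCyclotomicExtension {3} ℚ k] :
    ∃ (n : ℕ) (x : K), (n = 1 ∨ n = 2) ∧ x ≠ 0 ∧ τ (algebraMap (𝓞 K) K θ) =
      algebraMap (𝓞 K) K θ * algebraMap k K (algebraMap (𝓞 k) k π₂) ^ n * x ^ 3 := by
  have hgal := h.isGalois
  obtain ⟨e, ⟨u, v, huv⟩, hord⟩ := h.three_dvd_primeOrd_quotient
  -- The exponent n is e reduced modulo 3, nonzero because e is prime to 3; the multiple of 3 goes
  -- into the cube.
  obtain ⟨n, hn, m, rfl⟩ : ∃ n : ℕ, (n = 1 ∨ n = 2) ∧ ∃ m : ℤ, e = n + 3 * m := by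
    have h0 : e % 3 ≠ 0 := by
      intro h0
      obtain ⟨m, rfl⟩ := Int.dvd_of_emod_eq_zero h0
      have : (3 : ℤ) ∣ 1 := ⟨u * m + v, by linear_combination -huv⟩
      omega
    exact ⟨(e % 3).toNat, by omega, e / 3, by omega⟩
  obtain ⟨w₀, hw₀⟩ := h.admissible.norm_eq
  have hT0 := h.theta_ne_zero
  have hnorm := h.norm_eq (algebraMap (𝓞 K) K θ)
  have hw₀' : Algebra.norm k (algebraMap (𝓞 K) K θ) = (algebraMap (𝓞 k) k π₂ * w₀) ^ 3 := by
    rw [mul_pow]; exact hw₀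
  rw [hw₀', map_pow] at hnorm
  obtain ⟨c, hc⟩ : ∃ c, c = algebraMap (𝓞 k) k π₂ * w₀ := ⟨_, rfl⟩
  rw [← hc] at hnorm
  have hπ0 := h.pi_two_ne_zero
  have hττ := h.tau_tau_tau (algebraMap (𝓞 K) K θ)
  set T := algebraMap (𝓞 K) K θ with hT
  set p := algebraMap k K (algebraMap (𝓞 k) k π₂) with hp
  set C := algebraMap k K c with hC
  have hτC : τ C = C := τ.commutes c
  have hτp : τ p = p := τ.commutes _
  have hT1 : τ T ≠ 0 := by simpa using hT0
  have hT2 : τ (τ T) ≠ 0 := by simpa using hT0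
  have hC0 : C ≠ 0 := by
    intro h0
    rw [h0, zero_pow (by norm_num)] at hnorm
    exact mul_ne_zero (mul_ne_zero hT0 hT1) hT2 hnorm.symm
  -- C/τθ has norm C³/N(θ) = 1.
  obtain ⟨κ, hκ0, hκ⟩ := exists_eq_mul_of_cubic_norm_eq_one h.zeta_poly_field h.adjoin_eq_top
    h.apply_root h.root_ne_zero (δ := C / τ T) (by
      rw [map_div₀, map_div₀, hτC, hτC, hττ]
      field_simp
      linear_combination hnorm)
  -- Since τκ = (C/τT)κ, the quotient of the two sides is τT · τ²T · T / C³ = 1. Thus the twisted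
  -- ratio descends to b in k.
  have hfix : τ (τ T / (T * p ^ n) / κ ^ 3) = τ T / (T * p ^ n) / κ ^ 3 := by
    rw [map_div₀, map_div₀, map_mul, map_pow, map_pow, hτp, hκ]
    field_simp
    linear_combination -hnorm
  obtain ⟨b, hb⟩ := cubic_mem_range_of_fixed h.zeta_poly_field h.cube h.adjoin_eq_top h.apply_root
    hfix
  have hpn := pow_ne_zero n hπ0
  have hb0 : algebraMap k K b ≠ 0 := by
    rw [hb]
    exact div_ne_zero (div_ne_zero hT1 (mul_ne_zero hT0 hpn)) (pow_ne_zero 3 hκ0)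
  obtain ⟨ω, y, hω, hy⟩ := h.eq_root_of_unity_mul_cube (b := b) (by simpa using hb0) (fun w => by
    rw [hb, div_eq_mul_inv, div_eq_mul_inv, primeOrd_mul w
      (mul_ne_zero hT1 (inv_ne_zero (mul_ne_zero hT0 hpn))) (inv_ne_zero (pow_ne_zero 3 hκ0)),
      primeOrd_mul w hT1 (inv_ne_zero (mul_ne_zero hT0 hpn)), primeOrd_inv, primeOrd_inv,
      primeOrd_mul w hT0 hpn, primeOrd_pow, primeOrd_pow]
    obtain ⟨q, hq⟩ := hord w
    refine ⟨q + m * primeOrd w p - primeOrd w κ, ?_⟩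
    push_cast
    linear_combination hq)
  have hrel : τ T = algebraMap k K (algebraMap (𝓞 k) k ω) * (T * p ^ n * (y * κ) ^ 3) := by
    rw [hb] at hy
    field_simp at hy
    linear_combination hy
  have hω1 := h.root_of_unity_eq_one (ω := algebraMap (𝓞 k) (𝓞 K) ω)
    (by rw [← map_pow, hω, map_one]) hrel
  have hω2 : algebraMap k K (algebraMap (𝓞 k) k ω) = 1 := by
    have := congrArg (algebraMap (𝓞 K) K) hω1
    rw [map_one] at this
    exact this
  rw [hω2, one_mul] at hrel
  refine ⟨n, y * κ, hn, ?_, hrel⟩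
  intro h0
  rw [h0] at hrel
  exact hT1 (by rw [hrel]; ring)

end IsAdmissibleDatum

/-- The field `L = K(ρ₂, t)` obtained from `K = k(ρ₁)` by adjoining cube roots of `π₂` and `θ`,
assumed to be Galois over `k`. -/
structure IsRedeiExtension {k K L : Type*} [Field k] [NumberField k] [Field K] [NumberField K]
    [Field L] [NumberField L] [Algebra k K] [Algebra k L] [Algebra K L]
    (ζ π₁ π₂ : 𝓞 k) (ρ : K) (τ : K ≃ₐ[k] K) (P : HeightOneSpectrum (𝓞 K)) (θ : 𝓞 K)
    (ρ₂ t : L) : Prop extends IsAdmissibleDatum ζ π₁ π₂ ρ τ P θ where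
  galois : IsGalois k L
  cube₂ : ρ₂ ^ 3 = algebraMap k L (algebraMap (𝓞 k) k π₂)
  cube_theta : t ^ 3 = algebraMap K L (algebraMap (𝓞 K) K θ)
  adjoin_eq : IntermediateField.adjoin k {algebraMap K L ρ, ρ₂, t} = ⊤

theorem card_le_three_of_cube_eq {G L : Type*} [Field L] {z r : L} (hz : z ^ 2 + z + 1 = 0)
    (f : G → L) (hf : Function.Injective f) (hr : ∀ g, f g ^ 3 = r ^ 3) : Nat.card G ≤ 3 := by
  classical
  let s : Finset L := {r, z * r, z ^ 2 * r}
  have hs : ∀ g, f g ∈ s := fun g => by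
    obtain ⟨ω, hω, hg⟩ := exists_cube_root_unity_mul (hr g)
    rw [hg]
    rcases cube_eq_one_cases hz hω with rfl | rfl | rfl <;> simp [s]
  have := Nat.card_le_card_of_injective (fun g => (⟨f g, hs g⟩ : s))
    (fun a b hab => hf (congrArg Subtype.val hab))
  refine this.trans ?_
  rw [Nat.card_eq_fintype_card, Fintype.card_coe]
  exact Finset.card_le_three

theorem exists_integer_cube_root {K L : Type*} [Field K] [NumberField K] [Field L] [NumberField L]
    [Algebra K L] {a : 𝓞 K} {t : L} (ht : t ^ 3 = algebraMap K L (algebraMap (𝓞 K) K a)) :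
    ∃ r : 𝓞 L, algebraMap (𝓞 L) L r = t ∧ r ^ 3 = algebraMap (𝓞 K) (𝓞 L) a := by
  have hi : IsIntegral (𝓞 L) t := by
    refine IsIntegral.of_pow (n := 3) (by norm_num) ?_
    rw [ht]
    exact isIntegral_algebraMap (R := 𝓞 L) (x := algebraMap (𝓞 K) (𝓞 L) a)
  obtain ⟨r, hr⟩ := IsIntegrallyClosed.isIntegral_iff.1 hi
  refine ⟨r, hr, RingOfIntegers.coe_injective ?_⟩
  rw [map_pow, hr, ht]
  rfl

/-- If `π` is a prime element of `k` below `w` and a cube in `L`, then `w` has ramification index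
divisible by `3` over `k`. -/
theorem three_dvd_ramificationIdx {k L : Type*} [Field k] [NumberField k] [Field L] [NumberField L]
    [Algebra k L] {π : 𝓞 k} (hπ : Prime π) {r : L}
    (hr : r ^ 3 = algebraMap k L (algebraMap (𝓞 k) k π)) {w : HeightOneSpectrum (𝓞 L)}
    (hw : algebraMap (𝓞 k) (𝓞 L) π ∈ w.asIdeal) : 3 ∣ w.asIdeal.ramificationIdx (𝓞 k) := by
  have h := primeOrd_liesOver (L := L) (HeightOneSpectrum.restrict k w) w
    (x := algebraMap (𝓞 k) k π) (by simpa using hπ.ne_zero)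
  rw [primeOrd_self_of_prime (HeightOneSpectrum.restrict k w) hπ hw, ← hr, primeOrd_pow,
    mul_one] at h
  exact_mod_cast Dvd.intro _ h

/-! ### Ramification in the field of degree 27 -/

namespace IsRedeiExtension

variable {k K L : Type*} [Field k] [NumberField k] [Field K] [NumberField K] [Field L]
  [NumberField L] [Algebra k K] [Algebra k L] [Algebra K L] [IsScalarTower k K L]
  [IsCyclotomicExtension {3} ℚ k]
  {ζ π₁ π₂ : 𝓞 k} {ρ : K} {τ : K ≃ₐ[k] K} {P : HeightOneSpectrum (𝓞 K)} {θ : 𝓞 K} {ρ₂ t : L}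
  (h : IsRedeiExtension ζ π₁ π₂ ρ τ P θ ρ₂ t)
include h

omit [IsCyclotomicExtension {3} ℚ k] in
theorem cube_one : (algebraMap K L ρ) ^ 3 = algebraMap k L (algebraMap (𝓞 k) k π₁) := by
  rw [← map_pow, h.cube, ← IsScalarTower.algebraMap_apply]

omit [IsCyclotomicExtension {3} ℚ k] in
theorem apply_algebraMap_of_fixed {σ : L ≃ₐ[k] L} (hσ : σ (algebraMap K L ρ) = algebraMap K L ρ)
    (x : K) : σ (algebraMap K L x) = algebraMap K L x := by
  have hx : x ∈ k⟮ρ⟯ := h.adjoin_eq_top ▸ IntermediateField.mem_top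
  induction hx using IntermediateField.adjoin_induction with
  | mem x hx => rw [Set.mem_singleton_iff.1 hx, hσ]
  | algebraMap x => rw [← IsScalarTower.algebraMap_apply, AlgEquiv.commutes]
  | add x y _ _ hx hy => rw [map_add, map_add, hx, hy]
  | inv x _ hx => rw [map_inv₀, map_inv₀, hx]
  | mul x y _ _ hx hy => rw [map_mul, map_mul, hx, hy]

omit [IsCyclotomicExtension {3} ℚ k] [IsScalarTower k K L] in
theorem aut_ext {σ σ' : L ≃ₐ[k] L} (h1 : σ (algebraMap K L ρ) = σ' (algebraMap K L ρ))
    (h2 : σ ρ₂ = σ' ρ₂) (h3 : σ t = σ' t) : σ = σ' :=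
  algEquiv_ext_of_adjoin_eq_top h.adjoin_eq (by
    rintro x (rfl | rfl | rfl)
    exacts [h1, h2, h3])

omit [IsScalarTower k K L] in
theorem t_ne_zero : t ≠ 0 := by
  intro h0
  have := h.cube_theta
  rw [h0, zero_pow (by norm_num)] at this
  exact h.theta_ne_zero (by simpa using this.symm)

omit [IsScalarTower k K L] [IsCyclotomicExtension {3} ℚ k] in
theorem root_two_ne_zero : ρ₂ ≠ 0 := by
  intro h0
  have := h.cube₂
  rw [h0, zero_pow (by norm_num)] at this
  exact h.prime₂.ne_zero (by simpa using this.symm)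

/-- Such a σ fixes K pointwise, so only t is at stake. Above 3 the congruence with η³ is used;
elsewhere a σ-fixed element of the same order as t is exhibited. -/
theorem apply_t_eq_of_mem_inertia {w : HeightOneSpectrum (𝓞 L)} {σ : L ≃ₐ[k] L}
    (hσ : σ ∈ w.asIdeal.inertia (L ≃ₐ[k] L)) (hρ : σ (algebraMap K L ρ) = algebraMap K L ρ)
    (hρ₂ : algebraMap (𝓞 k) (𝓞 L) π₂ ∈ w.asIdeal → σ ρ₂ = ρ₂) : σ t = t := by
  have hfix := h.apply_algebraMap_of_fixed hρ
  have hfix' : ∀ x : 𝓞 K, σ • algebraMap (𝓞 K) (𝓞 L) x = algebraMap (𝓞 K) (𝓞 L) x := fun x =>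
    RingOfIntegers.coe_injective (hfix (algebraMap (𝓞 K) K x))
  have hcube : (σ t) ^ 3 = t ^ 3 := by rw [← map_pow, h.cube_theta, hfix]
  obtain ⟨ω', hω', hσt⟩ := exists_cube_root_unity_mul hcube
  obtain ⟨ω, rfl, hω⟩ := exists_integer_cube_root_unity hω'
  suffices ω = 1 by rw [hσt, this, map_one, one_mul]
  have hz : algebraMap (𝓞 k) (𝓞 L) ζ ^ 2 + algebraMap (𝓞 k) (𝓞 L) ζ + 1 = 0 := by
    rw [← map_pow, ← map_add, ← map_one (algebraMap (𝓞 k) (𝓞 L)), ← map_add, h.zeta_poly, map_zero]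
  have ht0 := h.t_ne_zero
  set v := HeightOneSpectrum.restrict K w with hv
  have hvk : ∀ x : 𝓞 k, algebraMap (𝓞 k) (𝓞 K) x ∈ v.asIdeal ↔
      algebraMap (𝓞 k) (𝓞 L) x ∈ w.asIdeal := fun x => by
    rw [IsScalarTower.algebraMap_apply (𝓞 k) (𝓞 K) (𝓞 L)]
    rfl
  by_cases hl : 2 * algebraMap (𝓞 k) (𝓞 L) ζ + 1 ∈ w.asIdeal
  · have hl' : algebraMap (𝓞 k) (𝓞 K) (2 * ζ + 1) ∈ v.asIdeal := by
      rw [hvk, map_add, map_mul, map_one, map_ofNat]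
      exact hl
    obtain ⟨r, rfl, hr⟩ := exists_integer_cube_root h.cube_theta
    obtain ⟨η, hη⟩ := h.admissible.cube_congr
    rw [Ideal.mem_span_singleton] at hη
    refine eq_one_of_mem_inertia_of_wild hσ hz (smul_algebraMap_integer σ ζ) hω (t := r)
      (η := algebraMap (𝓞 K) (𝓞 L) η) ?_ ?_ (hfix' η) ?_
    · intro hm
      have : algebraMap (𝓞 K) (𝓞 L) θ ∈ w.asIdeal :=
        hr ▸ w.asIdeal.pow_mem_of_mem hm 3 (by norm_num)
      exact h.theta_not_mem hl' this
    · apply RingOfIntegers.coe_injective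
      rw [map_mul]
      exact hσt
    · rw [hr, ← map_pow, ← map_sub, ← dvd_neg, ← map_neg, neg_sub, ← algebraMap_threeSqrtNegThree,
        IsScalarTower.algebraMap_apply (𝓞 k) (𝓞 K) (𝓞 L)]
      exact map_dvd _ hη
  · have hordt : 3 * primeOrd w t = w.asIdeal.ramificationIdx (𝓞 K) *
        primeOrd v (algebraMap (𝓞 K) K θ) := by
      rw [← primeOrd_liesOver (L := L) v w h.theta_ne_zero, ← h.cube_theta, primeOrd_pow]
      rfl
    by_cases hπ : algebraMap (𝓞 k) (𝓞 L) π₂ ∈ w.asIdeal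
    -- Here ord_v(π₂) = 1, so with m = ord_v(θ) the elements t³ = θ and (ρ₂^m)³ = π₂^m have equal
    -- order at w.
    · refine eq_one_of_mem_inertia_of_tame hσ hz hl hω ht0
        (c := ρ₂ ^ primeOrd v (algebraMap (𝓞 K) K θ)) hσt (by rw [map_zpow₀, hρ₂ hπ]) ?_
      rw [valuation_eq_iff_primeOrd_eq w ht0 (zpow_ne_zero _ h.root_two_ne_zero), primeOrd_zpow]
      have h2 : 3 * primeOrd w ρ₂ = w.asIdeal.ramificationIdx (𝓞 K) := by
        have := primeOrd_liesOver (L := L) v w h.pi_two_ne_zero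
        rw [h.primeOrd_prime h.prime₂ h.not_dvd ((hvk π₂).2 hπ), mul_one,
          ← IsScalarTower.algebraMap_apply, ← h.cube₂, primeOrd_pow] at this
        exact this
      have : (3 : ℤ) * primeOrd w t =
          3 * (primeOrd v (algebraMap (𝓞 K) K θ) * primeOrd w ρ₂) := by
        rw [hordt, ← h2]
        ring
      exact mul_left_cancel₀ (by norm_num) this
    -- Away from π₂ the order of θ at v is 3m, so an element of K of order m at v has the order of t
    -- at w.
    · obtain ⟨m, hm⟩ := h.three_dvd_primeOrd_theta (fun h' => hπ ((hvk π₂).1 h'))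
      obtain ⟨c, hc0, hc⟩ := exists_primeOrd_eq (K := K) v m
      refine eq_one_of_mem_inertia_of_tame hσ hz hl hω ht0 (c := algebraMap K L c) hσt (hfix c) ?_
      rw [valuation_eq_iff_primeOrd_eq w ht0 (by simpa using hc0), primeOrd_liesOver (L := L) v w hc0, hc]
      have : (3 : ℤ) * primeOrd w t = 3 * (w.asIdeal.ramificationIdx (𝓞 K) * m) := by
        rw [hordt, hm]
        ring
      exact mul_left_cancel₀ (by norm_num) this

omit [IsCyclotomicExtension {3} ℚ k] [IsScalarTower k K L] in
theorem not_mem_one_or_not_mem_two {w : HeightOneSpectrum (𝓞 L)}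
    (h2 : algebraMap (𝓞 k) (𝓞 L) π₂ ∈ w.asIdeal) : algebraMap (𝓞 k) (𝓞 L) π₁ ∉ w.asIdeal := by
  intro h1
  have hs := asIdeal_eq_span_of_prime_mem (HeightOneSpectrum.restrict k w) h.prime₂ h2
  have : π₁ ∈ (HeightOneSpectrum.restrict k w).asIdeal := h1
  rw [hs, Ideal.mem_span_singleton] at this
  exact h.not_dvd this

omit [IsCyclotomicExtension {3} ℚ k] in
theorem apply_root_one_of_mem_inertia {w : HeightOneSpectrum (𝓞 L)} {σ : L ≃ₐ[k] L}
    (hσ : σ ∈ w.asIdeal.inertia (L ≃ₐ[k] L)) (hw : algebraMap (𝓞 k) (𝓞 L) π₁ ∉ w.asIdeal) :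
    σ (algebraMap K L ρ) = algebraMap K L ρ :=
  map_eq_of_mem_inertia_of_cube_eq h.zeta_poly h.primary h.cube_one hw hσ

omit [IsScalarTower k K L] [IsCyclotomicExtension {3} ℚ k] in
theorem apply_root_two_of_mem_inertia {w : HeightOneSpectrum (𝓞 L)} {σ : L ≃ₐ[k] L}
    (hσ : σ ∈ w.asIdeal.inertia (L ≃ₐ[k] L)) (hw : algebraMap (𝓞 k) (𝓞 L) π₂ ∉ w.asIdeal) :
    σ ρ₂ = ρ₂ :=
  map_eq_of_mem_inertia_of_cube_eq h.zeta_poly h.primary₂ h.cube₂ hw hσ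

theorem isUnramifiedAt {w : HeightOneSpectrum (𝓞 L)}
    (h1 : algebraMap (𝓞 k) (𝓞 L) π₁ ∉ w.asIdeal) (h2 : algebraMap (𝓞 k) (𝓞 L) π₂ ∉ w.asIdeal) :
    Algebra.IsUnramifiedAt (𝓞 k) w.asIdeal := by
  have := h.galois
  refine isUnramifiedAt_of_inertia_eq_bot w (eq_bot_iff.2 fun σ hσ => ?_)
  have e1 := h.apply_root_one_of_mem_inertia hσ h1
  exact h.aut_ext e1 (h.apply_root_two_of_mem_inertia hσ h2)
    (h.apply_t_eq_of_mem_inertia hσ e1 fun h' => absurd h' h2)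

omit [IsScalarTower k K L] [IsCyclotomicExtension {3} ℚ k] in
theorem zeta_poly_top : algebraMap k L (algebraMap (𝓞 k) k ζ) ^ 2 +
    algebraMap k L (algebraMap (𝓞 k) k ζ) + 1 = 0 := by
  rw [← map_pow, ← map_add, ← map_one (algebraMap k L), ← map_add, h.zeta_poly_field, map_zero]

-- The inertia group embeds into the at most three cube roots of π, while its order is a positive
-- multiple of 3.
omit [IsScalarTower k K L] [IsCyclotomicExtension {3} ℚ k] in
theorem ramificationIdx_eq_three_of_injective {w : HeightOneSpectrum (𝓞 L)} {π : 𝓞 k}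
    (hπ : Prime π) {r : L} (hr : r ^ 3 = algebraMap k L (algebraMap (𝓞 k) k π))
    (hw : algebraMap (𝓞 k) (𝓞 L) π ∈ w.asIdeal)
    (hinj : ∀ σ ∈ w.asIdeal.inertia (L ≃ₐ[k] L), ∀ σ' ∈ w.asIdeal.inertia (L ≃ₐ[k] L),
      σ r = σ' r → σ = σ') : w.asIdeal.ramificationIdx (𝓞 k) = 3 := by
  have := h.galois
  have h3 := three_dvd_ramificationIdx hπ hr hw
  rw [← card_inertia_eq_ramificationIdx (F := k)] at h3 ⊢
  have hle : Nat.card (w.asIdeal.inertia (L ≃ₐ[k] L)) ≤ 3 :=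
    card_le_three_of_cube_eq h.zeta_poly_top (r := r) (fun σ => (σ : L ≃ₐ[k] L) r)
      (fun a b hab => Subtype.ext (hinj a a.2 b b.2 hab))
      (fun σ => by rw [← map_pow, hr, AlgEquiv.commutes])
  have hpos : 0 < Nat.card (w.asIdeal.inertia (L ≃ₐ[k] L)) := Nat.card_pos
  omega

theorem ext_of_mem_inertia_one {w : HeightOneSpectrum (𝓞 L)}
    (hw : algebraMap (𝓞 k) (𝓞 L) π₂ ∉ w.asIdeal) {σ σ' : L ≃ₐ[k] L}
    (hσ : σ ∈ w.asIdeal.inertia (L ≃ₐ[k] L)) (hσ' : σ' ∈ w.asIdeal.inertia (L ≃ₐ[k] L))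
    (hr : σ (algebraMap K L ρ) = σ' (algebraMap K L ρ)) : σ = σ' := by
  have hmem : σ'⁻¹ * σ ∈ w.asIdeal.inertia (L ≃ₐ[k] L) := mul_mem (inv_mem hσ') hσ
  have e1 : (σ'⁻¹ * σ) (algebraMap K L ρ) = algebraMap K L ρ := by
    rw [AlgEquiv.mul_apply, hr]
    exact σ'.symm_apply_apply _
  have : σ'⁻¹ * σ = 1 := h.aut_ext e1 (h.apply_root_two_of_mem_inertia hmem hw)
    (h.apply_t_eq_of_mem_inertia hmem e1 fun h' => absurd h' hw)
  exact (inv_mul_eq_one.1 this).symm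

theorem ext_of_mem_inertia_two {w : HeightOneSpectrum (𝓞 L)}
    (hw : algebraMap (𝓞 k) (𝓞 L) π₁ ∉ w.asIdeal) {σ σ' : L ≃ₐ[k] L}
    (hσ : σ ∈ w.asIdeal.inertia (L ≃ₐ[k] L)) (hσ' : σ' ∈ w.asIdeal.inertia (L ≃ₐ[k] L))
    (hr : σ ρ₂ = σ' ρ₂) : σ = σ' := by
  have hmem : σ'⁻¹ * σ ∈ w.asIdeal.inertia (L ≃ₐ[k] L) := mul_mem (inv_mem hσ') hσ
  have e1 : (σ'⁻¹ * σ) ρ₂ = ρ₂ := by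
    rw [AlgEquiv.mul_apply, hr]
    exact σ'.symm_apply_apply _
  have e2 := h.apply_root_one_of_mem_inertia hmem hw
  have : σ'⁻¹ * σ = 1 := h.aut_ext e2 e1 (h.apply_t_eq_of_mem_inertia hmem e2 fun _ => e1)
  exact (inv_mul_eq_one.1 this).symm

theorem ramificationIdx_one {w : HeightOneSpectrum (𝓞 L)}
    (hw : algebraMap (𝓞 k) (𝓞 L) π₁ ∈ w.asIdeal) : w.asIdeal.ramificationIdx (𝓞 k) = 3 :=
  h.ramificationIdx_eq_three_of_injective h.prime h.cube_one hw fun _ hσ _ hσ' =>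
    h.ext_of_mem_inertia_one (fun h2 => h.not_mem_one_or_not_mem_two h2 hw) hσ hσ'

theorem ramificationIdx_two {w : HeightOneSpectrum (𝓞 L)}
    (hw : algebraMap (𝓞 k) (𝓞 L) π₂ ∈ w.asIdeal) : w.asIdeal.ramificationIdx (𝓞 k) = 3 :=
  h.ramificationIdx_eq_three_of_injective h.prime₂ h.cube₂ hw fun _ hσ _ hσ' =>
    h.ext_of_mem_inertia_two (h.not_mem_one_or_not_mem_two hw) hσ hσ'

/-- Independence of ρ₁ and ρ₂ comes from ramification: the inertia group above π₁ has order 3 and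
fixes ρ₂, and a nontrivial element of it must move ρ₁. -/
theorem exists_aut_moving_root_one :
    ∃ σ : L ≃ₐ[k] L, σ (algebraMap K L ρ) ≠ algebraMap K L ρ ∧ σ ρ₂ = ρ₂ := by
  have := h.galois
  obtain ⟨w, hw⟩ := exists_heightOneSpectrum_mem (K := L) h.prime
  have h2 := fun h2 => h.not_mem_one_or_not_mem_two h2 hw
  have hc := h.ramificationIdx_one hw
  rw [← card_inertia_eq_ramificationIdx (F := k)] at hc
  have : Nontrivial (w.asIdeal.inertia (L ≃ₐ[k] L)) :=
    (Finite.one_lt_card_iff_nontrivial).1 (by omega)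
  obtain ⟨⟨σ, hσ⟩, hne⟩ := exists_ne (1 : w.asIdeal.inertia (L ≃ₐ[k] L))
  refine ⟨σ, fun h1 => hne (Subtype.ext ?_), h.apply_root_two_of_mem_inertia hσ h2⟩
  exact h.ext_of_mem_inertia_one h2 hσ (one_mem _) h1

theorem exists_aut_moving_root_two :
    ∃ σ : L ≃ₐ[k] L, σ (algebraMap K L ρ) = algebraMap K L ρ ∧ σ ρ₂ ≠ ρ₂ := by
  have := h.galois
  obtain ⟨w, hw⟩ := exists_heightOneSpectrum_mem (K := L) h.prime₂
  have h2 := h.not_mem_one_or_not_mem_two hw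
  have hc := h.ramificationIdx_two hw
  rw [← card_inertia_eq_ramificationIdx (F := k)] at hc
  have : Nontrivial (w.asIdeal.inertia (L ≃ₐ[k] L)) :=
    (Finite.one_lt_card_iff_nontrivial).1 (by omega)
  obtain ⟨⟨σ, hσ⟩, hne⟩ := exists_ne (1 : w.asIdeal.inertia (L ≃ₐ[k] L))
  refine ⟨σ, h.apply_root_one_of_mem_inertia hσ h2, fun h1 => hne (Subtype.ext ?_)⟩
  exact h.ext_of_mem_inertia_two h2 hσ (one_mem _) h1

end IsRedeiExtension

/-! ### Recognising the Heisenberg group -/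

section Heisenberg

/-- A group with coordinates `a, b, c` in `ZMod 3` that multiply like the entries of unitriangular
matrices, separate points, and are sufficiently nondegenerate, is the Heisenberg group. -/
theorem nonempty_mulEquiv_unitriangularGroup {G : Type*} [Group G] (a b c : G → ZMod 3) (n : ZMod 3)
    (hn : n * n = 1) (ha : ∀ g h, a (g * h) = a g + a h) (hb : ∀ g h, b (g * h) = b g + b h)
    (hc : ∀ g h, c (g * h) = c g + c h + n * (b g * a h))
    (hinj : ∀ g h, a g = a h → b g = b h → c g = c h → g = h)
    (h₁ : ∃ g, a g ≠ 0 ∧ b g = 0) (h₂ : ∃ g, a g = 0 ∧ b g ≠ 0) :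
    Nonempty (G ≃* unitriangularGroup 3 (ZMod 3)) := by
  have hsq : ∀ x : ZMod 3, x ≠ 0 → x * x = 1 := by decide
  have ha1 : a 1 = 0 := by simpa using ha 1 1
  have hb1 : b 1 = 0 := by simpa using hb 1 1
  have hc1 : c 1 = 0 := by simpa [ha1] using hc 1 1
  let f : G →* Matrix (Fin 3) (Fin 3) (ZMod 3) :=
    -- Rescaling c by n turns the cocycle n · b(g) · a(h) into the matrix one, since n² = 1.
    { toFun := fun g => !![1, b g, n * c g; 0, 1, a g; 0, 0, 1]
      map_one' := by
        rw [ha1, hb1, hc1, mul_zero]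
        exact Matrix.one_fin_three.symm
      map_mul' := fun g h => by
        rw [ha, hb, hc]
        ext i j
        fin_cases i <;> fin_cases j <;> simp [Matrix.mul_apply, Fin.sum_univ_three]
        · ring
        · linear_combination (b g * a h) * hn
        · ring }
  have hf : ∀ g, f g = !![1, b g, n * c g; 0, 1, a g; 0, 0, 1] := fun g => rfl
  have hmem : ∀ g, (∀ i, f g i i = 1) ∧ ∀ i j, j < i → f g i j = 0 := by
    intro g
    rw [hf]
    refine ⟨fun i => by fin_cases i <;> rfl, fun i j hij => ?_⟩
    fin_cases i <;> fin_cases j <;> first | rfl | exact absurd hij (by decide)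
  let F : G →* unitriangularGroup 3 (ZMod 3) :=
    f.toHomUnits.codRestrict (unitriangularGroup 3 (ZMod 3)) fun g => by
      rw [unitriangularGroup, Submonoid.mem_units_iff]
      exact ⟨hmem g, by rw [← map_inv]; exact hmem g⁻¹⟩
  have hF : ∀ g, (((F g : unitriangularGroup 3 (ZMod 3)) : GL (Fin 3) (ZMod 3)) :
      Matrix (Fin 3) (Fin 3) (ZMod 3)) = f g := fun g => rfl
  have hpa : ∀ g (m : ℕ), a (g ^ m) = m * a g := by
    intro g m
    induction m with
    | zero => simp [ha1]
    | succ m ih => rw [pow_succ, ha, ih]; push_cast; ring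
  have hpb : ∀ g (m : ℕ), b (g ^ m) = m * b g := by
    intro g m
    induction m with
    | zero => simp [hb1]
    | succ m ih => rw [pow_succ, hb, ih]; push_cast; ring
  have hpc : ∀ g (m : ℕ), a g = 0 → c (g ^ m) = m * c g := by
    intro g m hg
    induction m with
    | zero => simp [hc1]
    | succ m ih => rw [pow_succ, hc, ih, hg]; push_cast; ring
  have hval : ∀ x : ZMod 3, ((x.val : ℕ) : ZMod 3) = x := fun x => ZMod.natCast_zmod_val x
  refine ⟨MulEquiv.ofBijective F ⟨fun g h hgh => ?_, fun u => ?_⟩⟩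
  · have e : f g = f h := by rw [← hF, ← hF, hgh]
    rw [hf, hf] at e
    have e1 : b g = b h := congrFun (congrFun e 0) 1
    have e2 : n * c g = n * c h := congrFun (congrFun e 0) 2
    have e3 : a g = a h := congrFun (congrFun e 1) 2
    exact hinj g h e3 e1 (by linear_combination n * e2 - (c g - c h) * hn)
  · obtain ⟨g₁, hg1, hg1'⟩ := h₁
    obtain ⟨g₂, hg2, hg2'⟩ := h₂
    -- The commutator has a = b = 0 and c = n · b(g₂) · a(g₁) ≠ 0, so its powers adjust the corner
    -- entry alone.
    obtain ⟨z, hz⟩ : ∃ z, z = g₂ * g₁ * (g₁ * g₂)⁻¹ := ⟨_, rfl⟩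
    have hz' : z * (g₁ * g₂) = g₂ * g₁ := by rw [hz, inv_mul_cancel_right]
    have hza : a z = 0 := by
      have := congrArg a hz'
      rw [ha, ha, ha] at this
      linear_combination this
    have hzb : b z = 0 := by
      have := congrArg b hz'
      rw [hb, hb, hb] at this
      linear_combination this
    have hzc : c z = n * (b g₂ * a g₁) := by
      have := congrArg c hz'
      rw [hc, hc, hc, hzb, hg1'] at this
      linear_combination this
    have hzc2 : c z * c z = 1 := by
      rw [hzc]
      linear_combination (b g₂ * b g₂ * (a g₁ * a g₁)) * hn + (a g₁ * a g₁) * hsq _ hg2' + hsq _ hg1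
    let U : Matrix (Fin 3) (Fin 3) (ZMod 3) := ((u : GL (Fin 3) (ZMod 3)) : Matrix _ _ _)
    have hU : (∀ i, U i i = 1) ∧ ∀ i j, j < i → U i j = 0 := by
      have := (Submonoid.mem_units_iff _ _).1 u.2
      exact this.1
    -- Nonzero elements of `ZMod 3` are their own inverses, so multiplying by a(g₁) or b(g₂) acts as
    -- division.
    obtain ⟨g₀, hg0⟩ : ∃ g₀, g₀ = g₁ ^ (U 1 2 * a g₁).val * g₂ ^ (U 0 1 * b g₂).val := ⟨_, rfl⟩
    have ha0 : a g₀ = U 1 2 := by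
      rw [hg0, ha, hpa, hpa, hval, hg2]
      linear_combination U 1 2 * hsq _ hg1
    have hb0 : b g₀ = U 0 1 := by
      rw [hg0, hb, hpb, hpb, hval, hval, hg1']
      linear_combination U 0 1 * hsq _ hg2'
    obtain ⟨g, hg⟩ : ∃ g, g = z ^ ((n * U 0 2 - c g₀) * c z).val * g₀ := ⟨_, rfl⟩
    have hga : a g = U 1 2 := by rw [hg, ha, hpa, hza, ha0]; ring
    have hgb : b g = U 0 1 := by rw [hg, hb, hpb, hzb, hb0]; ring
    have hgc : n * c g = U 0 2 := by
      rw [hg, hc, hpc _ _ hza, hpb, hzb, hval]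
      linear_combination (n * (n * U 0 2 - c g₀)) * hzc2 + U 0 2 * hn
    refine ⟨g, Subtype.ext (Units.ext ?_)⟩
    rw [hF, hf, hga, hgb, hgc]
    change _ = U
    ext i j
    fin_cases i <;> fin_cases j <;> simp [hU.1, hU.2]

end Heisenberg

/-! ### From Kummer actions to coordinates -/

section KummerCharacter

/-- Identifies the cube roots of unity with `ZMod 3`, so that the action on radicals is recorded by
additive coordinates. -/
theorem exists_cube_root_character {L : Type*} [Field L] {z : L} (hz : IsPrimitiveRoot z 3) :
    ∃ χ : ZMod 3 → L, (∀ i j, χ (i + j) = χ i * χ j) ∧ Function.Injective χ ∧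
      (∀ ω : L, ω ^ 3 = 1 → ∃ i, χ i = ω) ∧ ∀ i, χ i = z ^ i.val := by
  refine ⟨fun i => z ^ i.val, fun i j => ?_, fun i j hij => ?_, fun ω hω => ?_, fun i => rfl⟩
  · change z ^ (i + j).val = z ^ i.val * z ^ j.val
    rw [← pow_add, ZMod.val_add]
    exact (pow_eq_pow_mod _ hz.pow_eq_one).symm
  · exact ZMod.val_injective 3 (hz.pow_inj (ZMod.val_lt i) (ZMod.val_lt j) hij)
  · obtain ⟨i, hi, rfl⟩ := hz.eq_pow_of_pow_eq_one hω
    exact ⟨i, congrArg (z ^ ·) (ZMod.val_natCast_of_lt hi)⟩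

/-- If the automorphism group of `L` acts through cube roots of unity on `A`, `B`, and permutes
the elements `s j` up to cube roots of unity according to the given rules, it is the Heisenberg
group. -/
theorem nonempty_mulEquiv_of_kummer_action {k L : Type*} [Field k] [Field L] [Algebra k L]
    {z : k} (hz : IsPrimitiveRoot z 3) {A B : L} {s y : ZMod 3 → L} {n : ℕ}
    (hn : (n : ZMod 3) * n = 1) (hA0 : A ≠ 0) (hB0 : B ≠ 0) (hs0 : ∀ j, s j ≠ 0)
    (hA : ∀ g : L ≃ₐ[k] L, (g A) ^ 3 = A ^ 3) (hB : ∀ g : L ≃ₐ[k] L, (g B) ^ 3 = B ^ 3)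
    (hy : ∀ (g : L ≃ₐ[k] L) (m : ℕ), g A = algebraMap k L z ^ m * A → ∀ j, g (y j) = y (j + m))
    (hs : ∀ j, s (j + 1) = B ^ n * y j * s j)
    (ht : ∀ (g : L ≃ₐ[k] L) (m : ℕ), g A = algebraMap k L z ^ m * A → (g (s 0)) ^ 3 = s m ^ 3)
    (hgen : ∀ g g' : L ≃ₐ[k] L, g A = g' A → g B = g' B → g (s 0) = g' (s 0) → g = g')
    (h₁ : ∃ g : L ≃ₐ[k] L, g A ≠ A ∧ g B = B) (h₂ : ∃ g : L ≃ₐ[k] L, g A = A ∧ g B ≠ B) :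
    Nonempty ((L ≃ₐ[k] L) ≃* unitriangularGroup 3 (ZMod 3)) := by
  obtain ⟨χ, χadd, χinj, χsurj, χval⟩ :=
    exists_cube_root_character (hz.map_of_injective (algebraMap k L).injective)
  have χfix : ∀ (g : L ≃ₐ[k] L) i, g (χ i) = χ i := fun g i => by
    rw [χval, map_pow, AlgEquiv.commutes]
  have χ0 : χ 0 = 1 := by rw [χval, ZMod.val_zero, pow_zero]
  have χne : ∀ i, χ i ≠ 0 := fun i h0 => by
    have := χadd i (-i)
    rw [add_neg_cancel, χ0, h0, zero_mul] at this
    exact one_ne_zero this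
  have χpow : ∀ i (m : ℕ), χ i ^ m = χ (m * i) := by
    intro i m
    induction m with
    | zero => rw [pow_zero, Nat.cast_zero, zero_mul, χ0]
    | succ m ih => rw [pow_succ, ih, ← χadd, Nat.cast_succ, add_mul, one_mul]
  have hchar : ∀ u v : L, u ^ 3 = v ^ 3 → ∃ i, u = χ i * v := fun u v huv => by
    obtain ⟨ω, hω, rfl⟩ := exists_cube_root_unity_mul huv
    obtain ⟨i, rfl⟩ := χsurj ω hω
    exact ⟨i, rfl⟩
  have χcancel : ∀ (i j) (u : L), u ≠ 0 → χ i * u = χ j * u → i = j := fun i j u hu hij =>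
    χinj (mul_right_cancel₀ hu hij)
  choose a ha using fun g : L ≃ₐ[k] L => hchar _ _ (hA g)
  choose b hb using fun g : L ≃ₐ[k] L => hchar _ _ (hB g)
  have hy' : ∀ (g : L ≃ₐ[k] L) j, g (y j) = y (j + a g) := fun g j => by
    have := hy g (a g).val (by rw [← χval]; exact ha g) j
    rwa [ZMod.natCast_zmod_val] at this
  have ht' : ∀ g : L ≃ₐ[k] L, g (s 0) ^ 3 = s (a g) ^ 3 := fun g => by
    have := ht g (a g).val (by rw [← χval]; exact ha g)
    rwa [ZMod.natCast_zmod_val] at this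
  choose c hc using fun g : L ≃ₐ[k] L => hchar _ _ (ht' g)
  -- Each step along the chain s multiplies by B^n, which g scales by χ(n · b(g)); the factor y only
  -- has its index shifted.
  have hstep : ∀ (g : L ≃ₐ[k] L) (j : ℕ),
      g (s j) = χ (c g + n * b g * j) * s (j + a g) := by
    intro g j
    induction j with
    | zero => rw [Nat.cast_zero, mul_zero, add_zero, zero_add, hc]
    | succ j ih =>
      rw [Nat.cast_succ, hs, map_mul, map_mul, map_pow, ih, hb, hy',
        show (j : ZMod 3) + 1 + a g = j + a g + 1 by ring, hs, mul_pow, χpow,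
        show c g + n * b g * (j + 1 : ZMod 3) = n * b g + (c g + n * b g * j) by ring, χadd (n * b g)]
      ring
  have hstep' : ∀ (g : L ≃ₐ[k] L) (j : ZMod 3), g (s j) = χ (c g + n * b g * j) * s (j + a g) := by
    intro g j
    have := hstep g j.val
    rwa [ZMod.natCast_zmod_val] at this
  have hamul : ∀ g h, a (g * h) = a g + a h := fun g h => by
    refine χcancel _ _ A hA0 ?_
    rw [← ha, AlgEquiv.mul_apply, ha h, map_mul, χfix, ha g, χadd]
    ring
  refine nonempty_mulEquiv_unitriangularGroup a b c n hn hamul (fun g h => ?_) (fun g h => ?_)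
    (fun g h e1 e2 e3 => hgen g h ?_ ?_ ?_) ?_ ?_
  · refine χcancel _ _ B hB0 ?_
    rw [← hb, AlgEquiv.mul_apply, hb h, map_mul, χfix, hb g, χadd]
    ring
  · refine χcancel _ _ (s (a (g * h))) (hs0 _) ?_
    rw [← hc, AlgEquiv.mul_apply, hc h, map_mul, χfix, hstep', hamul, add_comm (a h),
      show c g + c h + n * (b g * a h) = c h + (c g + n * b g * a h) by ring, χadd (c h)]
    ring
  · rw [ha, ha, e1]
  · rw [hb, hb, e2]
  · rw [hc, hc, e1, e3]
  · obtain ⟨g, h1, h2⟩ := h₁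
    refine ⟨g, fun h0 => h1 (by rw [ha, h0, χ0, one_mul]), χcancel _ _ B hB0 ?_⟩
    rw [← hb, h2, χ0, one_mul]
  · obtain ⟨g, h1, h2⟩ := h₂
    refine ⟨g, χcancel _ _ A hA0 ?_, fun h0 => h2 (by rw [hb, h0, χ0, one_mul])⟩
    rw [← ha, h1, χ0, one_mul]

end KummerCharacter

/-! ### The Galois group -/

theorem IsPrimaryCubicExtension.tau_pow_apply_root {k K : Type*} [Field k] [NumberField k]
    [Field K] [NumberField K] [Algebra k K] {ζ π : 𝓞 k} {ρ : K} {τ : K ≃ₐ[k] K}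
    (h : IsPrimaryCubicExtension ζ π ρ τ) (m : ℕ) :
    (τ ^ m) ρ = algebraMap k K (algebraMap (𝓞 k) k ζ) ^ m * ρ := by
  induction m with
  | zero => rw [pow_zero, pow_zero, one_mul]; rfl
  | succ m ih =>
    rw [pow_succ', AlgEquiv.mul_apply, ih, map_mul, map_pow, AlgEquiv.commutes, h.apply_root]
    ring

theorem IsPrimaryCubicExtension.tau_pow_val {k K : Type*} [Field k] [NumberField k]
    [Field K] [NumberField K] [Algebra k K] {ζ π : 𝓞 k} {ρ : K} {τ : K ≃ₐ[k] K}
    (h : IsPrimaryCubicExtension ζ π ρ τ) (m : ℕ) : τ ^ (m : ZMod 3).val = τ ^ m := by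
  have h3 : τ ^ 3 = 1 := by rw [pow_three', h.tau_cube]
  rw [ZMod.val_natCast]
  exact (pow_eq_pow_mod m h3).symm

/-- The element `x` with `τ θ = θ π₂ ^ n x ^ 3` satisfies `N(x) = π₂ ^ (-n)` exactly, because the
norm of `θ` is a cube in the base field. -/
theorem IsAdmissibleDatum.mul_norm_eq_one {k K : Type*} [Field k] [NumberField k]
    [IsCyclotomicExtension {3} ℚ k] [Field K] [NumberField K] [Algebra k K]
    {ζ π₁ π₂ : 𝓞 k} {ρ : K} {τ : K ≃ₐ[k] K} {P : HeightOneSpectrum (𝓞 K)} {θ : 𝓞 K}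
    (h : IsAdmissibleDatum ζ π₁ π₂ ρ τ P θ) {n : ℕ} {x : K}
    (hx : τ (algebraMap (𝓞 K) K θ) =
      algebraMap (𝓞 K) K θ * algebraMap k K (algebraMap (𝓞 k) k π₂) ^ n * x ^ 3) :
    algebraMap k K (algebraMap (𝓞 k) k π₂) ^ n * (x * τ x * τ (τ x)) = 1 := by
  obtain ⟨w₀, hw₀⟩ := h.admissible.norm_eq
  have hnorm := h.norm_eq (algebraMap (𝓞 K) K θ)
  have hw₀' : Algebra.norm k (algebraMap (𝓞 K) K θ) = (algebraMap (𝓞 k) k π₂ * w₀) ^ 3 := by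
    rw [mul_pow]; exact hw₀
  rw [hw₀', map_pow] at hnorm
  have hT0 := h.theta_ne_zero
  generalize algebraMap (𝓞 k) k π₂ * w₀ = c at hnorm
  set T := algebraMap (𝓞 K) K θ
  have hp0 := h.pi_two_ne_zero
  have hτp : τ (algebraMap k K (algebraMap (𝓞 k) k π₂)) =
    algebraMap k K (algebraMap (𝓞 k) k π₂) := τ.commutes _
  set p := algebraMap k K (algebraMap (𝓞 k) k π₂)
  have hτc : τ (algebraMap k K c) = algebraMap k K c := τ.commutes c
  generalize algebraMap k K c = C at hnorm hτc
  have hx0 : x ≠ 0 := by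
    rintro rfl
    have : τ T ≠ 0 := by simpa using hT0
    exact this (by rw [hx]; ring)
  have hx1 : τ x ≠ 0 := by simpa using hx0
  -- Taking norms in the relation determines p^n · N(x) only up to a cube root of unity. Instead,
  -- expanding N(θ) = C³ with the relation exhibits C as a root of unity times T p^n x² τ(x).
  have hcube : C ^ 3 = (T * p ^ n * x ^ 2 * τ x) ^ 3 := by
    rw [hnorm, hx, map_mul, map_mul, map_pow, map_pow, hτp, hx]
    ring
  obtain ⟨ω, hω, hC⟩ := exists_cube_root_unity_mul hcube
  have hz : algebraMap k K (algebraMap (𝓞 k) k ζ) ^ 2 + algebraMap k K (algebraMap (𝓞 k) k ζ) + 1 =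
      0 := by
    rw [← map_pow, ← map_add, ← map_one (algebraMap k K), ← map_add, h.zeta_poly_field, map_zero]
  have hτω : τ ω = ω := by
    rcases cube_eq_one_cases hz hω with rfl | rfl | rfl
    · exact map_one τ
    · exact τ.commutes _
    · rw [map_pow, AlgEquiv.commutes]
  have hω0 : ω ≠ 0 := by
    rintro rfl
    norm_num at hω
  -- C and ω are fixed by τ, so T p^n x² τ(x) is too; writing this out with the relation gives the
  -- claim.
  have e := hτc
  rw [hC] at e
  simp only [map_mul, map_pow, hτω, hτp, hx] at e
  have hne : ω * T * p ^ n * x ^ 2 * τ x ≠ 0 :=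
    mul_ne_zero (mul_ne_zero (mul_ne_zero (mul_ne_zero hω0 hT0) (pow_ne_zero n hp0))
      (pow_ne_zero 2 hx0)) hx1
  apply mul_left_cancel₀ hne
  linear_combination e

namespace IsRedeiExtension

variable {k K L : Type*} [Field k] [NumberField k] [Field K] [NumberField K] [Field L]
  [NumberField L] [Algebra k K] [Algebra k L] [Algebra K L] [IsScalarTower k K L]
  {ζ π₁ π₂ : 𝓞 k} {ρ : K} {τ : K ≃ₐ[k] K} {P : HeightOneSpectrum (𝓞 K)} {θ : 𝓞 K} {ρ₂ t : L}
  (h : IsRedeiExtension ζ π₁ π₂ ρ τ P θ ρ₂ t)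
include h

theorem apply_algebraMap_eq {σ : L ≃ₐ[k] L} {g : K ≃ₐ[k] K}
    (hσ : σ (algebraMap K L ρ) = algebraMap K L (g ρ)) (x : K) :
    σ (algebraMap K L x) = algebraMap K L (g x) := by
  have hx : x ∈ k⟮ρ⟯ := h.adjoin_eq_top ▸ IntermediateField.mem_top
  induction hx using IntermediateField.adjoin_induction with
  | mem x hx => rw [Set.mem_singleton_iff.1 hx, hσ]
  | algebraMap x => rw [← IsScalarTower.algebraMap_apply, AlgEquiv.commutes, AlgEquiv.commutes,
      ← IsScalarTower.algebraMap_apply]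
  | add x y _ _ hx hy => simp only [map_add, hx, hy]
  | inv x _ hx => simp only [map_inv₀, hx]
  | mul x y _ _ hx hy => simp only [map_mul, hx, hy]

/-- The elements s₀, s₁, s₂ are cube roots of θ, τθ, τ²θ linked by the relation and its conjugate,
so an automorphism acting as τ^m on K sends s₀ to a cube root of τ^m θ, that is, to s_m up to a root
of unity. -/
theorem nonempty_mulEquiv [IsCyclotomicExtension {3} ℚ k] :
    Nonempty ((L ≃ₐ[k] L) ≃* unitriangularGroup 3 (ZMod 3)) := by
  obtain ⟨n, x, hn, hx0, hx⟩ := h.exists_apply_theta_eq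
  have hN := congrArg (algebraMap K L) (h.mul_norm_eq_one hx)
  have hp : algebraMap K L (algebraMap k K (algebraMap (𝓞 k) k π₂)) = ρ₂ ^ 3 := by
    rw [h.cube₂, ← IsScalarTower.algebraMap_apply]
  rw [map_mul, map_pow, hp, map_mul, map_mul, map_one] at hN
  have hρ0 := h.root_two_ne_zero
  have ht0 := h.t_ne_zero
  have hxL : ∀ g : K ≃ₐ[k] K, algebraMap K L (g x) ≠ 0 := fun g => by simpa using hx0
  obtain ⟨s, hs0, hs1, hs2⟩ : ∃ s : ZMod 3 → L, s 0 = t ∧ s 1 = ρ₂ ^ n * algebraMap K L x * t ∧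
      s 2 = ρ₂ ^ n * algebraMap K L (τ x) * (ρ₂ ^ n * algebraMap K L x * t) :=
    ⟨fun j => if j = 0 then t else if j = 1 then ρ₂ ^ n * algebraMap K L x * t else
      ρ₂ ^ n * algebraMap K L (τ x) * (ρ₂ ^ n * algebraMap K L x * t), rfl, rfl, rfl⟩
  have hcases : ∀ j : ZMod 3, j = 0 ∨ j = 1 ∨ j = 2 := by decide
  have hpow : ∀ (σ : L ≃ₐ[k] L) (m : ℕ), σ (algebraMap K L ρ) =
      algebraMap k L (algebraMap (𝓞 k) k ζ) ^ m * algebraMap K L ρ →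
      ∀ y : K, σ (algebraMap K L y) = algebraMap K L ((τ ^ m) y) := fun σ m hσ =>
    h.apply_algebraMap_eq (by
      rw [hσ, h.tau_pow_apply_root, map_mul, map_pow, ← IsScalarTower.algebraMap_apply k K L])
  have hv0 : (0 : ZMod 3).val = 0 := rfl
  have hv1 : (1 : ZMod 3).val = 1 := rfl
  have hv2 : (2 : ZMod 3).val = 2 := rfl
  have hcube : ∀ j : ZMod 3, s j ^ 3 = algebraMap K L ((τ ^ j.val) (algebraMap (𝓞 K) K θ)) := by
    have h1 : s 1 ^ 3 = algebraMap K L (τ (algebraMap (𝓞 K) K θ)) := by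
      rw [hs1, mul_pow, mul_pow, h.cube_theta, hx, map_mul, map_mul, map_pow, map_pow, hp]
      ring
    intro j
    rcases hcases j with rfl | rfl | rfl
    · rw [hs0, hv0, h.cube_theta, pow_zero]; rfl
    · rw [hv1, pow_one, h1]
    · rw [hs2, ← hs1, mul_pow, h1, hv2, sq, AlgEquiv.mul_apply]
      conv_rhs => rw [hx]
      simp only [map_mul, map_pow, AlgEquiv.commutes, hp]
      ring
  refine nonempty_mulEquiv_of_kummer_action h.zeta_field (A := algebraMap K L ρ) (B := ρ₂) (s := s)
    (y := fun j => algebraMap K L ((τ ^ j.val) x)) (n := n) ?_ ?_ hρ0 ?_ ?_ ?_ ?_ ?_ ?_ ?_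
    h.exists_aut_moving_root_one h.exists_aut_moving_root_two
  · rcases hn with rfl | rfl <;> decide
  · simpa using h.root_ne_zero
  · intro j
    have hxL1 : algebraMap K L x ≠ 0 := hxL 1
    rcases hcases j with rfl | rfl | rfl
    · rwa [hs0]
    · rw [hs1]
      exact mul_ne_zero (mul_ne_zero (pow_ne_zero n hρ0) hxL1) ht0
    · rw [hs2]
      exact mul_ne_zero (mul_ne_zero (pow_ne_zero n hρ0) (hxL τ))
        (mul_ne_zero (mul_ne_zero (pow_ne_zero n hρ0) hxL1) ht0)
  · intro σ
    rw [← map_pow, h.cube_one, AlgEquiv.commutes]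
  · intro σ
    rw [← map_pow, h.cube₂, AlgEquiv.commutes]
  · intro σ m hσ j
    rw [hpow σ m hσ, ← AlgEquiv.mul_apply, ← pow_add]
    have e : j + (m : ZMod 3) = ((m + j.val : ℕ) : ZMod 3) := by
      rw [Nat.cast_add, ZMod.natCast_zmod_val, add_comm]
    rw [e, h.tau_pow_val]
  · intro j
    rcases hcases j with rfl | rfl | rfl
    · rw [zero_add, hs1, hs0, hv0, pow_zero]; rfl
    · rw [show (1 : ZMod 3) + 1 = 2 from rfl, hs2, hs1, hv1, pow_one]
    -- Closing the cycle from s₂ back to s₀ requires ρ₂^(3n) · N(x) = 1 exactly, not merely up to a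
    -- root of unity.
    · rw [show (2 : ZMod 3) + 1 = 0 from rfl, hs2, hs0, hv2, sq, AlgEquiv.mul_apply]
      linear_combination -t * hN
  · intro σ m hσ
    rw [hs0, ← map_pow, h.cube_theta, hpow σ m hσ, hcube, h.tau_pow_val]
  · intro σ σ' h1 h2 h3
    rw [hs0] at h3
    exact h.aut_ext h1 h2 h3

end IsRedeiExtension

/-! ### Primary generators as prime elements -/

namespace IsPrimaryGenerator

variable {k : Type*} [Field k] [NumberField k] {ζ π : 𝓞 k} {𝔭 : Ideal (𝓞 k)}
  (h : IsPrimaryGenerator ζ 𝔭 π)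
include h

theorem prime : Prime π := by
  have hp := h.isPrime
  rw [h.eq_span] at hp
  refine (Ideal.span_singleton_prime ?_).1 hp
  rintro rfl
  have hN := h.absNorm_modEq
  rw [h.eq_span, Ideal.span_singleton_zero, Ideal.absNorm_bot] at hN
  exact absurd hN (by decide)

theorem isMaximal : 𝔭.IsMaximal :=
  h.isPrime.isMaximal (by rw [h.eq_span]; simpa using h.prime.ne_zero)

theorem mem_iff {a : 𝓞 k} : a ∈ 𝔭 ↔ π ∣ a := by
  rw [h.eq_span, Ideal.mem_span_singleton]

theorem dvd_sub_one : threeSqrtNegThree ζ ∣ π - 1 := Ideal.mem_span_singleton.1 h.congr_one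

theorem liesOver_iff {L : Type*} [Field L] [Algebra k L] {Q : Ideal (𝓞 L)}
    [hQ : Q.IsPrime] : Q.LiesOver 𝔭 ↔ algebraMap (𝓞 k) (𝓞 L) π ∈ Q := by
  refine ⟨fun hl => (Ideal.mem_of_liesOver Q 𝔭 π).1 (h.mem_iff.2 dvd_rfl), fun hm => ⟨?_⟩⟩
  refine h.isMaximal.eq_of_le (hQ.comap _).ne_top fun x hx => ?_
  obtain ⟨c, rfl⟩ := h.mem_iff.1 hx
  rw [Ideal.mem_comap, map_mul]
  exact Q.mul_mem_right _ hm

theorem not_dvd {𝔮 : Ideal (𝓞 k)} {ϖ : 𝓞 k} (h' : IsPrimaryGenerator ζ 𝔮 ϖ) (hne : 𝔭 ≠ 𝔮) :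
    ¬ ϖ ∣ π := fun hd => hne <| h.isMaximal.eq_of_le h'.isMaximal.ne_top fun _ hx =>
  h'.mem_iff.2 (hd.trans (h.mem_iff.1 hx))

end IsPrimaryGenerator

theorem IntermediateField.mem_of_cube_eq {k Ω : Type*} [Field k] [Field Ω] [Algebra k Ω]
    {ζ : k} (hζ : ζ ^ 2 + ζ + 1 = 0) {F : IntermediateField k Ω} {a b : Ω} (hb : b ∈ F)
    (h : a ^ 3 = b ^ 3) : a ∈ F := by
  have hz : algebraMap k Ω ζ ^ 2 + algebraMap k Ω ζ + 1 = 0 := by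
    rw [← map_pow, ← map_add, ← map_one (algebraMap k Ω), ← map_add, hζ, map_zero]
  have hzF : algebraMap k Ω ζ ∈ F := F.algebraMap_mem ζ
  obtain ⟨ω, hω, rfl⟩ := exists_cube_root_unity_mul h
  refine F.mul_mem ?_ hb
  rcases cube_eq_one_cases hz hω with rfl | rfl | rfl
  · exact F.one_mem
  · exact hzF
  · exact pow_mem hzF 2

/-! ### Generators and normality of the extension -/

namespace IsAdmissibleDatum

variable {k K Ω : Type*} [Field k] [NumberField k] [Field K] [NumberField K]
  [Algebra k K] [Field Ω] [Algebra k Ω] [Algebra K Ω] [IsScalarTower k K Ω]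
  {ζ π₁ π₂ : 𝓞 k} {ρ : K} {τ : K ≃ₐ[k] K} {P : HeightOneSpectrum (𝓞 K)} {θ : 𝓞 K}
  (h : IsAdmissibleDatum ζ π₁ π₂ ρ τ P θ) [IsCyclotomicExtension {3} ℚ k]
include h

/-- θ generates K over k: the elements of K landing in F form an intermediate field containing θ,
and neither τ nor τ² fixes θ, so its fixing subgroup is trivial. -/
theorem algebraMap_mem {F : IntermediateField k Ω} (hθ : algebraMap K Ω θ ∈ F) (x : K) :
    algebraMap K Ω x ∈ F := by
  have := h.isGalois
  let E : IntermediateField k K := F.comap (IsScalarTower.toAlgHom k K Ω)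
  have hE : E.fixingSubgroup = ⊥ := by
    refine eq_bot_iff.2 fun g hg => ?_
    have hgθ : g (algebraMap (𝓞 K) K θ) = algebraMap (𝓞 K) K θ :=
      (mem_fixingSubgroup_iff _).1 hg _ hθ
    rcases h.aut_cases g with rfl | rfl | rfl
    · exact Subgroup.one_mem _
    · exact absurd hgθ h.apply_theta_ne
    · refine absurd ?_ h.apply_theta_ne
      rw [AlgEquiv.mul_apply] at hgθ
      conv_lhs => rw [← hgθ]
      exact h.tau_tau_tau _
  have hx : x ∈ E := by
    rw [← IsGalois.fixedField_fixingSubgroup E, hE, IntermediateField.fixedField_bot]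
    exact IntermediateField.mem_top
  exact hx

omit [IsCyclotomicExtension {3} ℚ k] in
theorem algebraMap_mem_of_root_mem {F : IntermediateField k Ω} (hρ : algebraMap K Ω ρ ∈ F)
    (x : K) : algebraMap K Ω x ∈ F := by
  have hle : k⟮ρ⟯ ≤ F.comap (IsScalarTower.toAlgHom k K Ω) :=
    IntermediateField.adjoin_simple_le_iff.2 hρ
  exact hle (h.adjoin_eq_top ▸ IntermediateField.mem_top)

variable {ρ₂ t₁ t₂ t₃ : Ω}
  (hρ₂ : ρ₂ ^ 3 = algebraMap k Ω π₂) (ht₁ : t₁ ^ 3 = algebraMap K Ω θ)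
  (ht₂ : t₂ ^ 3 = algebraMap K Ω (τ θ)) (ht₃ : t₃ ^ 3 = algebraMap K Ω (τ (τ θ)))
include hρ₂ ht₁ ht₂ ht₃

/-- By the relation, t₁ ρ₂^n x has cube τθ, and t₂ ρ₂^n τ(x) has cube τ²θ. Other choices of root
differ by cube roots of unity, which lie in k. -/
theorem conj_roots_mem {F : IntermediateField k Ω} (hρF : algebraMap K Ω ρ ∈ F) (hρ₂F : ρ₂ ∈ F)
    (ht₁F : t₁ ∈ F) : t₂ ∈ F ∧ t₃ ∈ F := by
  obtain ⟨n, x, -, -, hx⟩ := h.exists_apply_theta_eq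
  have hp : algebraMap K Ω (algebraMap k K (algebraMap (𝓞 k) k π₂)) = ρ₂ ^ 3 := by
    rw [hρ₂, ← IsScalarTower.algebraMap_apply k K Ω]
  have hx' := congrArg τ hx
  simp only [map_mul, map_pow, AlgEquiv.commutes] at hx'
  have hF := h.algebraMap_mem_of_root_mem hρF
  have ht₂F : t₂ ∈ F := by
    refine IntermediateField.mem_of_cube_eq h.zeta_poly_field
      (F.mul_mem (F.mul_mem ht₁F (pow_mem hρ₂F n)) (hF x)) ?_
    rw [ht₂, hx, mul_pow, mul_pow, ht₁, map_mul, map_mul, map_pow, map_pow, hp]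
    ring
  refine ⟨ht₂F, IntermediateField.mem_of_cube_eq h.zeta_poly_field
    (F.mul_mem (F.mul_mem ht₂F (pow_mem hρ₂F n)) (hF (τ x))) ?_⟩
  rw [ht₃, hx', mul_pow, mul_pow, ht₂, map_mul, map_mul, map_pow, map_pow, hp]
  ring

theorem adjoin_roots_eq : IntermediateField.adjoin k {algebraMap K Ω ρ, ρ₂, t₁} =
    IntermediateField.adjoin k {t₁, t₂, t₃} := by
  apply le_antisymm
  · set F := IntermediateField.adjoin k {t₁, t₂, t₃} with hFdef
    have ht₁F : t₁ ∈ F := IntermediateField.subset_adjoin _ _ (by simp)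
    have ht₂F : t₂ ∈ F := IntermediateField.subset_adjoin _ _ (by simp)
    have hF := h.algebraMap_mem (Ω := Ω) (F := F) (by rw [← ht₁]; exact pow_mem ht₁F 3)
    have hρ₂F : ρ₂ ∈ F := by
      obtain ⟨n, x, hn, hx0, hx⟩ := h.exists_apply_theta_eq
      have hp : algebraMap K Ω (algebraMap k K (algebraMap (𝓞 k) k π₂)) = ρ₂ ^ 3 := by
        rw [hρ₂, ← IsScalarTower.algebraMap_apply k K Ω]
      have hxΩ : algebraMap K Ω x ≠ 0 := by simpa using hx0
      have hθΩ : algebraMap K Ω (algebraMap (𝓞 K) K θ) ≠ 0 := by simpa using h.theta_ne_zero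
      have ht0 : t₁ ≠ 0 := by
        rintro rfl
        exact hθΩ (by rw [← ht₁]; norm_num)
      -- The relation solved for ρ₂^n: up to a cube root of unity it is t₂/(t₁x). When n = 2, ρ₂ is
      -- then recovered as ρ₂³/ρ₂², with ρ₂³ in k.
      have hpow : ρ₂ ^ n ∈ F := by
        refine IntermediateField.mem_of_cube_eq h.zeta_poly_field
          (F.div_mem ht₂F (F.mul_mem ht₁F (hF x))) ?_
        rw [div_pow, eq_div_iff (pow_ne_zero 3 (mul_ne_zero ht0 hxΩ)), ht₂, hx, mul_pow, ht₁,
          map_mul, map_mul, map_pow, map_pow, hp]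
        ring
      rcases hn with rfl | rfl
      · simpa using hpow
      · by_cases h0 : ρ₂ = 0
        · rw [h0]; exact F.zero_mem
        · have h3 : ρ₂ ^ 3 ∈ F := by rw [hρ₂]; exact F.algebraMap_mem _
          have := F.div_mem h3 hpow
          rwa [pow_succ, mul_div_cancel_left₀ _ (pow_ne_zero 2 h0)] at this
    rw [IntermediateField.adjoin_le_iff]
    rintro y (rfl | rfl | rfl)
    exacts [hF ρ, hρ₂F, ht₁F]
  · set F := IntermediateField.adjoin k {algebraMap K Ω ρ, ρ₂, t₁} with hFdef
    have ht₁F : t₁ ∈ F := IntermediateField.subset_adjoin _ _ (by simp)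
    obtain ⟨ht₂F, ht₃F⟩ := h.conj_roots_mem hρ₂ ht₁ ht₂ ht₃ (F := F)
      (IntermediateField.subset_adjoin _ _ (by simp))
      (IntermediateField.subset_adjoin _ _ (by simp)) ht₁F
    rw [IntermediateField.adjoin_le_iff]
    rintro y (rfl | rfl | rfl)
    exacts [ht₁F, ht₂F, ht₃F]

/-- An embedding over k preserves K, multiplies ρ₂ by a cube root of unity, and sends t₁ to a cube
root of a conjugate of θ; all of these already lie in the field. -/
theorem isGalois_adjoin_roots [Normal k Ω] :
    IsGalois k (IntermediateField.adjoin k {algebraMap K Ω ρ, ρ₂, t₁}) := by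
  set F := IntermediateField.adjoin k {algebraMap K Ω ρ, ρ₂, t₁} with hFdef
  have hρF : algebraMap K Ω ρ ∈ F := IntermediateField.subset_adjoin _ _ (by simp)
  have hρ₂F : ρ₂ ∈ F := IntermediateField.subset_adjoin _ _ (by simp)
  have ht₁F : t₁ ∈ F := IntermediateField.subset_adjoin _ _ (by simp)
  obtain ⟨ht₂F, ht₃F⟩ := h.conj_roots_mem hρ₂ ht₁ ht₂ ht₃ hρF hρ₂F ht₁F
  have := h.isGalois
  have hnormal : Normal k F := by
    refine IntermediateField.normal_iff_forall_map_le.2 fun σ => ?_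
    rw [hFdef, IntermediateField.adjoin_map, IntermediateField.adjoin_le_iff, ← hFdef]
    have hσ : ∀ x, σ (algebraMap K Ω x) = algebraMap K Ω (σ.restrictNormal' K x) := fun x =>
      (σ.restrictNormal_commutes K x).symm
    rintro _ ⟨y, rfl | rfl | rfl, rfl⟩
    · change σ _ ∈ F
      rw [hσ]
      exact h.algebraMap_mem_of_root_mem hρF _
    · refine IntermediateField.mem_of_cube_eq h.zeta_poly_field hρ₂F ?_
      rw [← map_pow, hρ₂, AlgHom.commutes]
    · change σ y ∈ F
      have e : (σ y) ^ 3 = algebraMap K Ω (σ.restrictNormal' K θ) := by rw [← map_pow, ht₁, hσ]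
      rcases h.aut_cases (σ.restrictNormal' K) with hg | hg | hg <;> rw [hg] at e
      · exact IntermediateField.mem_of_cube_eq h.zeta_poly_field ht₁F (e.trans ht₁.symm)
      · exact IntermediateField.mem_of_cube_eq h.zeta_poly_field ht₂F (e.trans ht₂.symm)
      · exact IntermediateField.mem_of_cube_eq h.zeta_poly_field ht₃F (e.trans ht₃.symm)
  exact ⟨⟩

end IsAdmissibleDatum

/-! ### The main theorem -/

theorem theorem4p10
    {k : Type*} [Field k] [NumberField k] [IsCyclotomicExtension {3} ℚ k]
    {Ω : Type*} [Field Ω] [Algebra k Ω] [IsAlgClosure k Ω]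
    -- the fixed cube root of unity and the two primes of `k`
    (ζ : 𝓞 k) (hζ : IsPrimitiveRoot ζ 3)
    (𝔭₁ 𝔭₂ : Ideal (𝓞 k)) (π₁ π₂ : 𝓞 k) (hne : 𝔭₁ ≠ 𝔭₂)
    (h₁ : IsPrimaryGenerator ζ 𝔭₁ π₁) (h₂ : IsPrimaryGenerator ζ 𝔭₂ π₂)
    (h₁₂ : IsCubicResidueSymbol π₁ 𝔭₂ 1) (h₂₁ : IsCubicResidueSymbol π₂ 𝔭₁ 1)
    -- cube roots `ρ₁`, `ρ₂` of `π₁`, `π₂`; the field `K₁ = k(ρ₁)`, its automorphism `τ` and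
    -- a prime `𝔓` of `K₁` over `𝔭₂`
    (ρ₁ ρ₂ : Ω) (hρ₁ : ρ₁ ^ 3 = algebraMap k Ω π₁) (hρ₂ : ρ₂ ^ 3 = algebraMap k Ω π₂)
    (τ : k⟮ρ₁⟯ ≃ₐ[k] k⟮ρ₁⟯)
    (hτ : (τ (IntermediateField.AdjoinSimple.gen k ρ₁) : Ω) = algebraMap k Ω ζ * ρ₁)
    (𝔓 : Ideal (𝓞 k⟮ρ₁⟯)) (h𝔓 : 𝔓.IsPrime) (h𝔓₂ : 𝔓.LiesOver 𝔭₂)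
    -- the integer `θ` and cube roots of its conjugates `θ`, `τ θ`, `τ² θ`
    (θ : 𝓞 k⟮ρ₁⟯) (hθ : IsAdmissible ζ π₂ τ 𝔓 θ)
    (t₁ t₂ t₃ : Ω) (ht₁ : t₁ ^ 3 = ((θ : k⟮ρ₁⟯) : Ω))
    (ht₂ : t₂ ^ 3 = ((τ (θ : k⟮ρ₁⟯)) : Ω)) (ht₃ : t₃ ^ 3 = ((τ (τ (θ : k⟮ρ₁⟯))) : Ω))
    (R : IntermediateField k Ω) (hR : R = IntermediateField.adjoin k {ρ₁, ρ₂, t₁}) :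
    R = IntermediateField.adjoin k {t₁, t₂, t₃} ∧
    IsGalois k R ∧
    (∀ (Q : Ideal (𝓞 R)) [Q.IsPrime], ¬ Q.LiesOver 𝔭₁ → ¬ Q.LiesOver 𝔭₂ →
      Algebra.IsUnramifiedAt (𝓞 k) Q) ∧
    IsUnramifiedAtInfinitePlaces k R ∧
    (∀ Q : Ideal (𝓞 R), Q.IsPrime → (Q.LiesOver 𝔭₁ ∨ Q.LiesOver 𝔭₂) →
      Q.ramificationIdx (𝓞 k) = 3) ∧
    Nonempty ((R ≃ₐ[k] R) ≃* unitriangularGroup 3 (ZMod 3)) := by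
  have hm₁ := h₁.isMaximal
  have hm₂ := h₂.isMaximal
  have hρR : ρ₁ ∈ R := hR ▸ IntermediateField.subset_adjoin _ _ (by simp)
  have hρ₂R : ρ₂ ∈ R := hR ▸ IntermediateField.subset_adjoin _ _ (by simp)
  have ht₁R : t₁ ∈ R := hR ▸ IntermediateField.subset_adjoin _ _ (by simp)
  have hd : ¬ π₂ ∣ π₁ := h₁.not_dvd h₂ hne
  have hπ𝔓 : algebraMap (𝓞 k) (𝓞 k⟮ρ₁⟯) π₂ ∈ 𝔓 := h₂.liesOver_iff.1 h𝔓₂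
  have h𝔓0 : 𝔓 ≠ ⊥ := by
    rintro rfl
    exact h₂.prime.ne_zero (by simpa using hπ𝔓)
  obtain ⟨b, hb⟩ := exists_cube_sub_mem (h₂.absNorm_modEq.of_mul_right 3)
    (fun hc => hd (h₂.mem_iff.1 hc)) h₁₂
  have h : IsAdmissibleDatum ζ π₁ π₂ (IntermediateField.AdjoinSimple.gen k ρ₁) τ
      ⟨𝔓, h𝔓, h𝔓0⟩ θ :=
    { zeta := hζ
      prime := h₁.prime
      primary := h₁.dvd_sub_one
      cube := Subtype.ext hρ₁
      adjoin_eq_top := by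
        apply IntermediateField.map_injective (IntermediateField.val _)
        rw [IntermediateField.adjoin_map, ← AlgHom.fieldRange_eq_map,
          IntermediateField.fieldRange_val, Set.image_singleton]
        rfl
      apply_root := Subtype.ext hτ
      prime₂ := h₂.prime
      primary₂ := h₂.dvd_sub_one
      not_dvd := hd
      cube_residue := ⟨b, h₂.mem_iff.1 hb⟩
      mem := hπ𝔓
      admissible := hθ }
  have hnormal : Normal k Ω := IsAlgClosure.normal k Ω
  have hgal : IsGalois k R := hR ▸ h.isGalois_adjoin_roots hρ₂ ht₁ ht₂ ht₃
  refine ⟨hR.trans (h.adjoin_roots_eq hρ₂ ht₁ ht₂ ht₃), hgal, ?_⟩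
  have hfin : FiniteDimensional k R := hR ▸ IntermediateField.finiteDimensional_adjoin
    fun x _ => (Algebra.IsAlgebraic.isAlgebraic (R := k) x).isIntegral
  have : NumberField R := NumberField.of_module_finite k R
  let : Algebra k⟮ρ₁⟯ R :=
    (IntermediateField.inclusion (IntermediateField.adjoin_simple_le_iff.2 hρR)).toRingHom.toAlgebra
  have : IsScalarTower k k⟮ρ₁⟯ R := IsScalarTower.of_algebraMap_eq fun _ => rfl
  have hL : IsRedeiExtension ζ π₁ π₂ (IntermediateField.AdjoinSimple.gen k ρ₁) τ
      ⟨𝔓, h𝔓, h𝔓0⟩ θ (⟨ρ₂, hρ₂R⟩ : R) ⟨t₁, ht₁R⟩ :=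
    { h with
      galois := hgal
      cube₂ := Subtype.ext hρ₂
      cube_theta := Subtype.ext ht₁
      adjoin_eq := by
        apply IntermediateField.map_injective R.val
        rw [IntermediateField.adjoin_map, ← AlgHom.fieldRange_eq_map,
          IntermediateField.fieldRange_val, Set.image_insert_eq,
          Set.image_pair]
        exact hR.symm }
  have hmem : ∀ {Q : Ideal (𝓞 R)} {π : 𝓞 k}, Prime π → algebraMap (𝓞 k) (𝓞 R) π ∈ Q → Q ≠ ⊥ := by
    rintro _ π hπ hQ rfl
    exact hπ.ne_zero (by simpa using hQ)
  refine ⟨fun Q hQ hQ₁ hQ₂ => ?_, ⟨fun w => ?_⟩, fun Q hQ hl => ?_, hL.nonempty_mulEquiv⟩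
  · rcases eq_or_ne Q ⊥ with rfl | hQ0
    · exact Algebra.isUnramifiedAt_bot
    · exact hL.isUnramifiedAt (w := ⟨Q, hQ, hQ0⟩) (fun hc => hQ₁ (h₁.liesOver_iff.2 hc))
        fun hc => hQ₂ (h₂.liesOver_iff.2 hc)
  -- The base field has no real place, so nothing can ramify at infinity.
  · have := IsCyclotomicExtension.Rat.isTotallyComplex k (n := 3) (by norm_num)
    exact InfinitePlace.isUnramified_iff.2 (Or.inr (IsTotallyComplex.isComplex _))
  · rcases hl with hl | hl
    · have hπ := h₁.liesOver_iff.1 hl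
      exact hL.ramificationIdx_one (w := ⟨Q, hQ, hmem h₁.prime hπ⟩) hπ
    · have hπ := h₂.liesOver_iff.1 hl
      exact hL.ramificationIdx_two (w := ⟨Q, hQ, hmem h₂.prime hπ⟩) hπ
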